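/- Let $G$ be a connected (finite-dimensional, real) Lie group with identity $e$ and Lie algebra $\mathfrak g$, and let $\varphi=\{\varphi_t\}_{t\in\mathbb R}$ be a flow of automorphisms of $G$, i.e. a (smooth) one-parameter subgroup of $\mathrm{Aut}(G)$. Let $\mathcal D$ be the derivation of $\mathfrak g$ with $(d\varphi_t)_e=e^{t\mathcal D}$ for all $t\in\mathbb R$, and let $\mathcal D=\mathcal D_{\mathcal H}+\mathcal D_{\mathcal E}+\mathcal D_{\mathcal N}$ be its Jordan decomposition: the summands commute, $\mathcal D_{\mathcal H}$ is semisimple with real eigenvalues, $\mathcal D_{\mathcal E}$ is semisimple with purely imaginary (possibly zero) complex eigenvalues, and $\mathcal D_{\mathcal N}$ is nilpotent. Let $\varphi_t=\varphi^{\mathcal H}_t\circ\varphi^{\mathcal E}_t\circ\varphi^{\mathcal N}_t$ be the corresponding decomposition of $\varphi$ into commuting flows of automorphisms with associated derivations $\mathcal D_{\mathcal H},\mathcal D_{\mathcal E},\mathcal D_{\mathcal N}$. Let $\mathfrak g^{+}$ (resp. $\mathfrak g^{-}$) be the sum of the eigenspaces of $\mathcal D_{\mathcal H}$ for its positive (resp.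 negative) eigenvalues, let $G^{\pm}$ be the connected subgroup of $G$ with Lie algebra $\mathfrak g^{\pm}$, i.e. the subgroup generated by $\exp(\mathfrak g^{\pm})$, let $G^0=\{g\in G:\varphi^{\mathcal H}_t(g)=g\ \text{for all } t\in\mathbb R\}$, and put $G^{+,0}=G^+G^0$. The subgroup $G^0$ is $\varphi$-invariant. For a flow $\psi$ of automorphisms of a topological group $K$ with identity $e$, a neighborhood $U$ of $e$ and $\tau>0$, a $(U,\tau)$-chain from $x$ to $y$ consists of an integer $n\ge 1$, points $x_0=x,x_1,\dots,x_n=y$ in $K$ and times $\tau_0,\dots,\tau_{n-1}\ge\tau$ such that $x_{i+1}^{-1}\psi_{\tau_i}(x_i)\in U$ for $i=0,\dots,n-1$. The chain recurrent set $\mathcal R_C(\psi)$ is the set of all $x\in K$ such that for every neighborhood $U$ of $e$ in $K$ and every $\tau>0$ there is a $(U,\tau)$-chain from $x$ to $x$. Then $$\mathcal R_C(\varphi)\cap G^{+,0}G^-=\mathcal R_C\left(\varphi|_{G^0}\right),$$ where $G^0$ carries the subspace topology and $\mathcal R_C(\varphi|_{G^0})\subset G^0$ is regarded as a subset of $G$.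 -/

import Mathlib

open scoped Manifold ContDiff Pointwise Topology

noncomputable section

namespace ChainRec

/-! ### Real Jordan decomposition of an endomorphism -/

section LinearAlgebra

variable {V : Type*} [AddCommGroup V] [Module ℝ V]

/-- Semisimple, with all complex eigenvalues real. -/
def IsHyperbolic (D : Module.End ℝ V) : Prop :=
  D.IsSemisimple ∧ ∀ μ : ℂ, Module.End.HasEigenvalue (LinearMap.baseChange ℂ D) μ → μ.im = 0

/-- Semisimple, with all complex eigenvalues on the imaginary axis. -/
def IsElliptic (D : Module.End ℝ V) : Prop :=
  D.IsSemisimple ∧ ∀ μ : ℂ, Module.End.HasEigenvalue (LinearMap.baseChange ℂ D) μ → μ.re = 0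

/-- `D = D_H + D_E + D_N` with commuting hyperbolic, elliptic and nilpotent summands. -/
structure IsJordanDecomposition (D : Module.End ℝ V)
    (P : Module.End ℝ V × Module.End ℝ V × Module.End ℝ V) : Prop where
  eq_add : D = P.1 + P.2.1 + P.2.2
  hyperbolic : IsHyperbolic P.1
  elliptic : IsElliptic P.2.1
  nilpotent : IsNilpotent P.2.2
  commute_HE : Commute P.1 P.2.1
  commute_HN : Commute P.1 P.2.2
  commute_EN : Commute P.2.1 P.2.2

theorem exists_real_interpolation (s : Finset ℂ)
    (hs : ∀ μ ∈ s, (starRingEnd ℂ) μ ∈ s) :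
    ∃ q : Polynomial ℝ, ∀ μ ∈ s, Polynomial.aeval μ q = (μ.re : ℂ) := by
  classical
  let p : Polynomial ℂ := Lagrange.interpolate s id (fun μ => (μ.re : ℂ))
  have hp : ∀ μ ∈ s, p.eval μ = (μ.re : ℂ) := fun μ hμ =>
    Lagrange.eval_interpolate_at_node (v := id) (fun μ : ℂ => (μ.re : ℂ))
      (Set.injOn_id _) hμ
  refine ⟨∑ i ∈ Finset.range (p.natDegree + 1), Polynomial.monomial i (p.coeff i).re, ?_⟩
  intro μ hμ
  have h1 := hp μ hμ
  have h2 := hp _ (hs μ hμ)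
  rw [Polynomial.eval_eq_sum_range] at h1 h2
  have h3 := congrArg (starRingEnd ℂ) h2
  simp only [map_sum, map_mul, map_pow, Complex.conj_conj, Complex.conj_re,
    Complex.conj_ofReal] at h3
  simp only [map_sum, Polynomial.aeval_monomial, Complex.coe_algebraMap]
  have h4 : (2 : ℂ) * ∑ i ∈ Finset.range (p.natDegree + 1), ((p.coeff i).re : ℂ) * μ ^ i
      = 2 * (μ.re : ℂ) := by
    rw [two_mul (μ.re : ℂ)]
    nth_rewrite 1 [← h1]
    rw [← h3, ← Finset.sum_add_distrib, Finset.mul_sum]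
    refine Finset.sum_congr rfl fun i _ => ?_
    rw [← add_mul, Complex.add_conj]
    push_cast
    ring
  exact mul_left_cancel₀ two_ne_zero h4

variable [FiniteDimensional ℝ V]

theorem eigenvalue_aeval (S : Module.End ℝ V) (q : Polynomial ℝ) (ν : ℂ)
    (h : Module.End.HasEigenvalue (LinearMap.baseChange ℂ (Polynomial.aeval S q)) ν) :
    ∃ μ : ℂ, Module.End.HasEigenvalue (LinearMap.baseChange ℂ S) μ ∧
      ν = Polynomial.aeval μ q := by
  have hnt : Nontrivial (TensorProduct ℝ ℂ V) := by
    obtain ⟨v, hv⟩ := h.exists_hasEigenvector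
    exact ⟨v, 0, hv.2⟩
  have key : LinearMap.baseChange ℂ (Polynomial.aeval S q)
      = Polynomial.aeval (LinearMap.baseChange ℂ S) (q.map (algebraMap ℝ ℂ)) := by
    rw [Polynomial.aeval_map_algebraMap]
    exact (Polynomial.aeval_algHom_apply (Module.End.baseChangeHom ℝ ℂ V) S q).symm
  rw [key] at h
  have h2 := h.mem_spectrum
  rw [spectrum.map_polynomial_aeval_of_nonempty _ _
    (spectrum.nonempty_of_isAlgClosed_of_finiteDimensional ℂ _)] at h2
  obtain ⟨μ, hμ, rfl⟩ := h2
  exact ⟨μ, Module.End.HasEigenvalue.of_mem_spectrum hμ, by simp [Polynomial.eval_map_algebraMap]⟩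

theorem exists_isJordanDecomposition (D : Module.End ℝ V) :
    ∃ P, IsJordanDecomposition D P := by
  classical
  obtain ⟨N, hN, S, hS, hnil, hss, hD⟩ := D.exists_isNilpotent_isSemisimple
  let s : Finset ℂ := ((minpoly ℝ S).aroots ℂ).toFinset
  have hm : minpoly ℝ S ≠ 0 := minpoly.ne_zero (Algebra.IsIntegral.isIntegral S)
  have hmem : ∀ μ : ℂ, μ ∈ s ↔ Polynomial.aeval μ (minpoly ℝ S) = 0 := fun μ => by
    simp [s, hm]
  obtain ⟨q, hq⟩ := exists_real_interpolation s (fun μ hμ => by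
    rw [hmem] at hμ ⊢
    rw [Polynomial.aeval_conj, hμ, map_zero])
  have heig : ∀ μ : ℂ, Module.End.HasEigenvalue (LinearMap.baseChange ℂ S) μ → μ ∈ s := by
    intro μ hμ
    rw [hmem]
    obtain ⟨v, hv⟩ := hμ.exists_hasEigenvector
    have h1 := Module.End.aeval_apply_of_hasEigenvector
      (p := (minpoly ℝ S).map (algebraMap ℝ ℂ)) hv
    have h0 : Polynomial.aeval (LinearMap.baseChange ℂ S) ((minpoly ℝ S).map (algebraMap ℝ ℂ))
        = 0 := by
      rw [Polynomial.aeval_map_algebraMap]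
      have := Polynomial.aeval_algHom_apply (Module.End.baseChangeHom ℝ ℂ V) S (minpoly ℝ S)
      rw [minpoly.aeval, map_zero] at this
      exact this
    rw [h0, LinearMap.zero_apply, Polynomial.eval_map_algebraMap] at h1
    exact (smul_eq_zero.mp h1.symm).resolve_right hv.2
  have hc : ∀ {a b c : Module.End ℝ V}, Commute a b → c ∈ Algebra.adjoin ℝ {a} → Commute c b :=
    fun hab hc => (Algebra.commute_of_mem_adjoin_of_forall_mem_commute hc
      (fun x hx => Set.mem_singleton_iff.mp hx ▸ hab.symm)).symm
  have hcSN : Commute S N := hc (hc (Commute.refl D) hN).symm hS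
  have hp : ∀ p : Polynomial ℝ, Polynomial.aeval S p ∈ Algebra.adjoin ℝ {S} :=
    fun p => Polynomial.aeval_mem_adjoin_singleton ℝ S
  refine ⟨(Polynomial.aeval S q, Polynomial.aeval S (Polynomial.X - q), N), ?_, ⟨?_, ?_⟩,
    ⟨?_, ?_⟩, hnil, ?_, ?_, ?_⟩
  · simp [hD, add_comm]
  · exact hss.aeval q
  · intro ν hν
    obtain ⟨μ, hμ, rfl⟩ := eigenvalue_aeval S q ν hν
    rw [hq μ (heig μ hμ), Complex.ofReal_im]
  · exact hss.aeval _
  · intro ν hν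
    obtain ⟨μ, hμ, rfl⟩ := eigenvalue_aeval S _ ν hν
    rw [map_sub, Polynomial.aeval_X, hq μ (heig μ hμ), Complex.sub_re, Complex.ofReal_re, sub_self]
  · exact hc (hc (Commute.refl S) (hp _)).symm (hp q)
  · exact hc hcSN (hp q)
  · exact hc hcSN (hp _)

/-- The (unique) triple `(D_H, D_E, D_N)` of the Jordan decomposition of `D`. -/
def jordanParts (D : Module.End ℝ V) : Module.End ℝ V × Module.End ℝ V × Module.End ℝ V :=
  (exists_isJordanDecomposition D).choose

theorem jordanParts_spec (D : Module.End ℝ V) : IsJordanDecomposition D (jordanParts D) :=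
  (exists_isJordanDecomposition D).choose_spec

/-- The sum of the eigenspaces of `D_H` for positive eigenvalues. -/
def unstableSubspace (D : Module.End ℝ V) : Submodule ℝ V :=
  ⨆ (r : ℝ) (_ : 0 < r), Module.End.eigenspace (jordanParts D).1 r

/-- The sum of the eigenspaces of `D_H` for negative eigenvalues. -/
def stableSubspace (D : Module.End ℝ V) : Submodule ℝ V :=
  ⨆ (r : ℝ) (_ : r < 0), Module.End.eigenspace (jordanParts D).1 r

end LinearAlgebra

/-! ### Chains -/

section Chains

variable {K : Type*} [Group K] [TopologicalSpace K]

/-- There is a `(U, τ)`-chain with at least one jump from `x` to `y`. -/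
def HasChain (φ : ℝ → K → K) (U : Set K) (τ : ℝ) (x y : K) : Prop :=
  ∃ (n : ℕ) (z : ℕ → K) (σ : ℕ → ℝ), 0 < n ∧ z 0 = x ∧ z n = y ∧
    ∀ i < n, τ ≤ σ i ∧ (z (i + 1))⁻¹ * φ (σ i) (z i) ∈ U

/-- The chain limit set `Ω(x)`. -/
def chainLimitSet (φ : ℝ → K → K) (x : K) : Set K :=
  {y | ∀ U ∈ 𝓝 (1 : K), ∀ τ : ℝ, 0 < τ → HasChain φ U τ x y}

/-- The chain recurrent set. -/
def chainRecurrentSet (φ : ℝ → K → K) : Set K :=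
  {x | x ∈ chainLimitSet φ x}

end Chains

/-! ### Flows of automorphisms of a Lie group -/

section LieGroup

variable {E : Type*} [NormedAddCommGroup E] [NormedSpace ℝ E]

/-- A flow of automorphisms: a one-parameter group of automorphisms of the group `G`, acting
smoothly. -/
structure AutFlow (E : Type*) [NormedAddCommGroup E] [NormedSpace ℝ E]
    (G : Type*) [TopologicalSpace G] [ChartedSpace E G] [Group G] where
  toFun : ℝ → G → G
  contMDiff' : ContMDiff (𝓘(ℝ, ℝ).prod 𝓘(ℝ, E)) 𝓘(ℝ, E) ∞ (fun p : ℝ × G => toFun p.1 p.2)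
  map_mul' : ∀ t x y, toFun t (x * y) = toFun t x * toFun t y
  map_zero' : ∀ x, toFun 0 x = x
  map_add' : ∀ s t x, toFun (s + t) x = toFun s (toFun t x)

variable {G : Type*} [TopologicalSpace G] [ChartedSpace E G] [Group G]

instance : CoeFun (AutFlow E G) (fun _ => ℝ → G → G) := ⟨AutFlow.toFun⟩

/-- `X = γ'(0)` for the smooth one-parameter subgroup `γ` of `G`, that is,
`γ t = exp (t X)`. -/
structure IsOneParameterSubgroup (γ : ℝ → G) (X : GroupLieAlgebra 𝓘(ℝ, E) G) : Prop where
  contMDiff : ContMDiff 𝓘(ℝ, ℝ) 𝓘(ℝ, E) ∞ γ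
  map_add : ∀ s t, γ (s + t) = γ s * γ t
  deriv_zero : (mfderiv 𝓘(ℝ, ℝ) 𝓘(ℝ, E) γ 0 : ℝ →L[ℝ] E) 1 = X

/-- The connected subgroup of `G` with Lie algebra `h` (for `h` a Lie subalgebra): the subgroup
generated by `exp h`. -/
def connectedSubgroup (h : Submodule ℝ (GroupLieAlgebra 𝓘(ℝ, E) G)) : Subgroup G :=
  Subgroup.closure {g | ∃ X ∈ h, ∃ γ : ℝ → G, IsOneParameterSubgroup γ X ∧ γ 1 = g}

namespace AutFlow

/-- The derivation `D` of the Lie algebra with `(dφ_t)_e = exp (t D)`, as the derivative of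
`t ↦ (dφ_t)_e` at `t = 0`. -/
def derivation (φ : AutFlow E G) : Module.End ℝ (GroupLieAlgebra 𝓘(ℝ, E) G) :=
  ((deriv (fun t : ℝ => (mfderiv 𝓘(ℝ, E) 𝓘(ℝ, E) (φ t) (1 : G) : E →L[ℝ] E)) 0 :
    E →L[ℝ] E) : E →ₗ[ℝ] E)

theorem map_one (φ : AutFlow E G) (t : ℝ) : φ t 1 = 1 := by
  have h := φ.map_mul' t 1 1
  rw [mul_one] at h
  exact left_eq_mul.mp h

theorem map_inv (φ : AutFlow E G) (t : ℝ) (x : G) : φ t x⁻¹ = (φ t x)⁻¹ := by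
  rw [eq_inv_iff_mul_eq_one, ← φ.map_mul', inv_mul_cancel, φ.map_one]

instance [FiniteDimensional ℝ E] : FiniteDimensional ℝ (GroupLieAlgebra 𝓘(ℝ, E) G) :=
  inferInstanceAs (FiniteDimensional ℝ E)

variable [FiniteDimensional ℝ E]

/-- The Jordan decomposition `φ_t = φ^H_t ∘ φ^E_t ∘ φ^N_t` of a flow of automorphisms into the
commuting flows of automorphisms associated with the parts `D_H, D_E, D_N` of its derivation. -/
structure IsJordanDecomposition (φ φH φE φN : AutFlow E G) : Prop where
  eq_comp : ∀ t x, φ t x = φH t (φE t (φN t x))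
  commute_HE : ∀ s t x, φH s (φE t x) = φE t (φH s x)
  commute_HN : ∀ s t x, φH s (φN t x) = φN t (φH s x)
  commute_EN : ∀ s t x, φE s (φN t x) = φN t (φE s x)
  derivation_H : φH.derivation = (jordanParts φ.derivation).1
  derivation_E : φE.derivation = (jordanParts φ.derivation).2.1
  derivation_N : φN.derivation = (jordanParts φ.derivation).2.2

/-- The unstable subgroup `G⁺`. -/
def unstableSubgroup (φ : AutFlow E G) : Subgroup G :=
  connectedSubgroup (E := E) (unstableSubspace φ.derivation)

/-- The stable subgroup `G⁻`. -/
def stableSubgroup (φ : AutFlow E G) : Subgroup G :=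
  connectedSubgroup (E := E) (stableSubspace φ.derivation)

/-- The central subgroup `G⁰`: the fixed points of the hyperbolic part of `φ` (the Jordan
decomposition of a flow of automorphisms of a connected Lie group exists and is unique). -/
def centralSubgroup (φ : AutFlow E G) : Subgroup G where
  carrier := {g | ∀ φH φE φN : AutFlow E G, IsJordanDecomposition φ φH φE φN → ∀ t, φH t g = g}
  mul_mem' {a b} ha hb φH φE φN h t := by
    rw [φH.map_mul', ha φH φE φN h t, hb φH φE φN h t]
  one_mem' φH _ _ _ t := φH.map_one t
  inv_mem' {a} ha φH φE φN h t := by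
    rw [φH.map_inv, ha φH φE φN h t]

theorem map_mem_centralSubgroup (φ : AutFlow E G) (t : ℝ) {x : G}
    (hx : x ∈ φ.centralSubgroup) : φ t x ∈ φ.centralSubgroup := by
  intro φH φE φN h s
  rw [h.eq_comp, ← φH.map_add', add_comm, φH.map_add', h.commute_HE, h.commute_HN,
    hx φH φE φN h s]

/-- The restriction `φ|_{G⁰}`. -/
def restrictCentral (φ : AutFlow E G) : ℝ → φ.centralSubgroup → φ.centralSubgroup :=
  fun t x => ⟨φ t x, φ.map_mem_centralSubgroup t x.2⟩

end AutFlow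

end LieGroup

end ChainRec

end

/-! Let `Z = G⁰` be the fixed points of the hyperbolic part `φ^H`, and let `S`, `U` be the subgroups
of points that `φ^H` carries to `1` as `t → +∞`, respectively `t → -∞`. Since `G⁻ ⊆ S` and `G⁺ ⊆ U`,
it is enough to treat `U Z S`.

A jump of a chain is `b = φ_σ(a) w⁻¹` with a small error `w` on the right. If `a = u z c` with `c`
in a small set `C ⊆ S` and `σ` is large, then `φ_σ(c) w⁻¹` is near `1`, hence equals some `u' z' c'`
with `z'` small and `c' ∈ C`. As `Z` normalizes `U`, the factor `u'` can be moved left across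
`φ_σ(z)`, so `b ∈ U · φ_σ(z) z' · c'`. Thus the `S`-components stay in `C` while the `Z`-components
form a chain in `Z`. Choosing `C` to avoid a given `s ≠ 1` shows that a chain recurrent `u z s` has
`s = 1` (`stable_part_eq_one`). Chain recurrence survives time reversal, which exchanges `S` and
`U`, so `u = 1` as well; for points of `Z` the `Z`-components give a closed chain in `Z`
(`mem_chainRecurrentSet_restrict`). The other inclusion is immediate.

`HyperbolicSplitting` isolates the properties used. On a Lie group, coordinates of the second kind
along an eigenbasis of `D_H` give the local product. The stable directions are contracted by `φ`
itself, because exponential decay beats the bounded elliptic and polynomially growing nilpotent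
parts. Uniqueness of the factors comes from the velocity of `φ^H` (`eq_one_of_tendsto`). Since
`centralSubgroup` quantifies over all Jordan decompositions, the formal case of no decomposition has
`G⁰ = G` and is handled by `trivialSplitting`. -/

noncomputable section

namespace ChainRec

open Filter Set

/-! ### Chains as a transitive closure -/

section Chains

variable {K : Type*} [Group K]

/-- One jump of a `(U, τ)`-chain. -/
def ChainStep (φ : ℝ → K → K) (U : Set K) (τ : ℝ) (x y : K) : Prop :=
  ∃ σ : ℝ, τ ≤ σ ∧ y⁻¹ * φ σ x ∈ U

/-- With chains as a transitive closure, projecting, refining and reversing them become inductions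
or monotonicity statements about one jump. -/
theorem hasChain_iff_transGen {φ : ℝ → K → K} {U : Set K} {τ : ℝ} {x y : K} :
    HasChain φ U τ x y ↔ Relation.TransGen (ChainStep φ U τ) x y := by
  constructor
  · rintro ⟨n, z, σ, hn, rfl, rfl, h⟩
    induction n with
    | zero => exact absurd hn (lt_irrefl 0)
    | succ n ih =>
      have hs : ChainStep φ U τ (z n) (z (n + 1)) := ⟨σ n, h n n.lt_succ_self⟩
      rcases Nat.eq_zero_or_pos n with rfl | hpos
      · exact .single hs
      · exact (ih hpos fun i hi => h i (hi.trans n.lt_succ_self)).tail hs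
  · intro h
    induction h with
    | single h =>
      rename_i b
      obtain ⟨σ, hσ⟩ := h
      refine ⟨1, fun i => if i = 0 then x else b, fun _ => σ, one_pos, by simp, by simp, ?_⟩
      intro i hi
      obtain rfl : i = 0 := by omega
      simpa using hσ
    | tail _ h ih =>
      rename_i b c _
      obtain ⟨σ, hσ⟩ := h
      obtain ⟨n, z, ρ, hn, h0, hz, hc⟩ := ih
      refine ⟨n + 1, fun i => if i ≤ n then z i else c, fun i => if i < n then ρ i else σ,
        n.succ_pos, by simp [h0], by simp, ?_⟩
      intro i hi
      rcases Nat.lt_succ_iff_lt_or_eq.mp hi with h | rfl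
      · have h' : i + 1 ≤ n := h
        simpa [h, h.le, h'] using hc i h
      · simpa [hz] using hσ

end Chains

/-! ### Flows of automorphisms of a topological group with a hyperbolic splitting -/

section TopologicalGroup

variable {K : Type*} [Group K] [TopologicalSpace K]

/-- A continuous one-parameter group of automorphisms of a topological group. -/
structure IsAutFlow (φ : ℝ → K → K) : Prop where
  continuous : Continuous fun p : ℝ × K => φ p.1 p.2
  map_mul : ∀ t x y, φ t (x * y) = φ t x * φ t y
  map_zero : ∀ x, φ 0 x = x
  map_add : ∀ s t x, φ (s + t) x = φ s (φ t x)

namespace IsAutFlow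

variable {φ : ℝ → K → K}

theorem map_one (hφ : IsAutFlow φ) (t : ℝ) : φ t 1 = 1 := by
  have h := hφ.map_mul t 1 1
  rw [mul_one] at h
  exact left_eq_mul.mp h

theorem map_inv (hφ : IsAutFlow φ) (t : ℝ) (x : K) : φ t x⁻¹ = (φ t x)⁻¹ := by
  rw [eq_inv_iff_mul_eq_one, ← hφ.map_mul, inv_mul_cancel, hφ.map_one]

theorem neg_apply_apply (hφ : IsAutFlow φ) (t : ℝ) (x : K) : φ (-t) (φ t x) = x := by
  rw [← hφ.map_add, neg_add_cancel, hφ.map_zero]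

theorem continuous_apply (hφ : IsAutFlow φ) (t : ℝ) : Continuous (φ t) :=
  hφ.continuous.comp (Continuous.prodMk_right t)

/-- The time-reversed flow. -/
theorem reverse (hφ : IsAutFlow φ) : IsAutFlow fun t => φ (-t) where
  continuous := hφ.continuous.comp (by fun_prop : Continuous fun p : ℝ × K => (-p.1, p.2))
  map_mul t := hφ.map_mul (-t)
  map_zero x := by rw [neg_zero, hφ.map_zero]
  map_add s t x := by rw [neg_add, hφ.map_add]

/-- Long jumps can be cut into pieces of bounded duration. -/
theorem transGen_bounded (hφ : IsAutFlow φ) {U : Set K} (hU : (1 : K) ∈ U) {τ : ℝ} (hτ : 0 < τ)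
    {x y : K} (h : ChainStep φ U τ x y) :
    Relation.TransGen (fun a b => ∃ σ ∈ Icc τ (2 * τ), b⁻¹ * φ σ a ∈ U) x y := by
  obtain ⟨σ, hσ, hxy⟩ := h
  obtain ⟨n, hn⟩ := exists_nat_ge (σ / τ)
  rw [div_le_iff₀ hτ] at hn
  induction n generalizing x σ with
  | zero => exact absurd hn (by push_cast; linarith)
  | succ n ih =>
    by_cases h2 : σ ≤ 2 * τ
    · exact .single ⟨σ, ⟨hσ, h2⟩, hxy⟩
    -- Since `σ > 2τ`, cutting off an error-free jump of length `τ` leaves a duration still at least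
    -- `τ`.
    · refine .head (b := φ τ x) ⟨τ, ⟨le_rfl, by linarith⟩, by simpa using hU⟩
        (ih (σ - τ) (by linarith) ?_ (by push_cast at hn; linarith))
      rw [← hφ.map_add, sub_add_cancel]
      exact hxy

/-- If `w = b⁻¹ φ_σ(a)`, then `a⁻¹ φ_{-σ}(b) = φ_{-σ}(w)⁻¹`. This error can be controlled only for
bounded `σ`, hence the cutting into durations in `[τ, 2τ]`. -/
theorem transGen_swap_reverse (hφ : IsAutFlow φ) {U : Set K} {τ : ℝ}
    (h1 : (1 : K) ∈ {u : K | ∀ σ ∈ Icc τ (2 * τ), (φ (-σ) u)⁻¹ ∈ U}) (hτ : 0 < τ) {a b : K}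
    (h : ChainStep φ {u : K | ∀ σ ∈ Icc τ (2 * τ), (φ (-σ) u)⁻¹ ∈ U} τ a b) :
    Relation.TransGen (Function.swap (ChainStep (fun t => φ (-t)) U τ)) a b := by
  refine Relation.TransGen.mono ?_ _ _ (hφ.transGen_bounded h1 hτ h)
  rintro a b ⟨σ, hσ, hab⟩
  refine ⟨σ, hσ.1, ?_⟩
  have := hab σ hσ
  rwa [hφ.map_mul, hφ.map_inv, hφ.neg_apply_apply, mul_inv_rev, inv_inv] at this

variable [IsTopologicalGroup K]

/-- Compactness of `[τ, 2τ]` yields one neighbourhood of `1` whose reversed errors all lie in `U`; a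
closed chain with errors in it can be run backwards. -/
theorem chainRecurrentSet_subset_reverse (hφ : IsAutFlow φ) :
    chainRecurrentSet φ ⊆ chainRecurrentSet fun t => φ (-t) := by
  intro x hx U hU τ hτ
  have hc : Continuous fun p : K × ℝ => (φ (-p.2) p.1)⁻¹ :=
    (hφ.reverse.continuous.comp continuous_swap).inv
  have hev : ∀ᶠ u in 𝓝 (1 : K), ∀ σ ∈ Icc τ (2 * τ), (φ (-σ) u)⁻¹ ∈ U := by
    refine isCompact_Icc.eventually_forall_of_forall_eventually fun σ _ => ?_
    refine hc.continuousAt.eventually_mem ?_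
    simpa [hφ.map_one] using hU
  have h := hasChain_iff_transGen.mp (hx _ hev τ hτ)
  rw [hasChain_iff_transGen]
  have h1 : (1 : K) ∈ {u : K | ∀ σ ∈ Icc τ (2 * τ), (φ (-σ) u)⁻¹ ∈ U} := mem_of_mem_nhds hev
  exact Relation.transGen_swap.mp
    (Relation.TransGen.closed (fun _ _ => hφ.transGen_swap_reverse h1 hτ) _ _ h)

end IsAutFlow

theorem mem_chainRecurrentSet_of_restrict {φ : ℝ → K → K} {Z : Subgroup K} {ψ : ℝ → Z → Z}
    (hψ : ∀ t z, (ψ t z : K) = φ t z) {z : Z} (hz : z ∈ chainRecurrentSet ψ) :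
    (z : K) ∈ chainRecurrentSet φ := by
  intro V hV τ hτ
  have hV' : ((↑) : Z → K) ⁻¹' V ∈ 𝓝 (1 : Z) :=
    continuous_subtype_val.continuousAt.preimage_mem_nhds (by simpa using hV)
  rw [hasChain_iff_transGen]
  refine (hasChain_iff_transGen.mp (hz _ hV' τ hτ)).lift (fun z : Z => (z : K)) ?_
  rintro a b ⟨σ, hσ, hab⟩
  exact ⟨σ, hσ, by simpa [hψ] using hab⟩

/-- A flow of automorphisms preserving subgroups `S`, `Z`, `U`, such that `S` is contracted,
`Z` normalizes `U`, the product `U Z S` is direct and covers a neighborhood of `1`. -/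
structure HyperbolicSplitting (φ : ℝ → K → K) (S Z U : Subgroup K) : Prop where
  flow : IsAutFlow φ
  map_stable : ∀ t, ∀ x ∈ S, φ t x ∈ S
  map_central : ∀ t, ∀ x ∈ Z, φ t x ∈ Z
  map_unstable : ∀ t, ∀ x ∈ U, φ t x ∈ U
  conj_mem : ∀ z ∈ Z, ∀ u ∈ U, z * u * z⁻¹ ∈ U
  eq_one_of_mem_stable : ∀ u ∈ U, ∀ z ∈ Z, u * z ∈ S → u * z = 1
  eq_one_of_mem_central : ∀ u ∈ U, u ∈ Z → u = 1
  tendsto_stable : ∀ s ∈ S, Tendsto (fun t => φ t s) atTop (𝓝 1)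
  local_product : ∀ V ∈ 𝓝 (1 : K), ∃ C ⊆ (S : Set K) ∩ V,
    (∀ W ∈ 𝓝 (1 : K), ∀ᶠ t in atTop, ∀ c ∈ C, φ t c ∈ W) ∧
    {x | ∃ u ∈ U, ∃ z ∈ Z, z ∈ V ∧ ∃ c ∈ C, x = u * z * c} ∈ 𝓝 (1 : K)

namespace HyperbolicSplitting

variable {φ : ℝ → K → K} {S Z U : Subgroup K}

/-- A step of a fine enough chain starting near `U Z` decomposes. -/
theorem mul_eq (h : HyperbolicSplitting φ S Z U) {t : ℝ} {u z c w u' z' c' : K} (hu : u ∈ U)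
    (hz : z ∈ Z) (hu' : u' ∈ U) (he : φ t c * w = u' * z' * c') :
    ∃ u'' ∈ U, φ t (u * z * c) * w = u'' * (φ t z * z') * c' := by
  -- The factor `u'` crosses `φ t z` to the left at the price of a conjugation, which stays in `U`.
  refine ⟨φ t u * (φ t z * u' * (φ t z)⁻¹), U.mul_mem (h.map_unstable t u hu)
    (h.conj_mem _ (h.map_central t z hz) _ hu'), ?_⟩
  rw [h.flow.map_mul, h.flow.map_mul, mul_assoc _ _ w, he]
  group

/-- As `Z` normalizes `U`, the set `UZ` is a subgroup, so `s` lies in `UZ ∩ S`, which is trivial. -/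
theorem stable_eq_one (h : HyperbolicSplitting φ S Z U) {u z u' z' s : K} (hu : u ∈ U)
    (hz : z ∈ Z) (hu' : u' ∈ U) (hz' : z' ∈ Z) (hs : s ∈ S) (he : u * z * s = u' * z') :
    s = 1 := by
  have h1 : s = (z⁻¹ * (u⁻¹ * u') * z⁻¹⁻¹) * (z⁻¹ * z') := by
    rw [eq_comm, ← mul_right_inj (u * z), he]
    group
  have h2 := h.eq_one_of_mem_stable _ (h.conj_mem _ (Z.inv_mem hz) _
    (U.mul_mem (U.inv_mem hu) hu')) _ (Z.mul_mem (Z.inv_mem hz) hz') (h1 ▸ hs)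
  rw [h1, h2]

variable [IsTopologicalGroup K]

/-- The set `C` traps stable components: long times carry `C` into `W`, and an error in `W` leads
back to a stable factor in `C`. It suffices that `W W⁻¹` lie in the neighbourhood covered by the
local product. -/
theorem exists_trapping (h : HyperbolicSplitting φ S Z U) {V : Set K} (hV : V ∈ 𝓝 1) :
    ∃ C ⊆ (S : Set K) ∩ V, ∃ W ∈ 𝓝 (1 : K),
      (∀ᶠ t in atTop, ∀ c ∈ C, φ t c ∈ W) ∧
      ∀ a ∈ W, ∀ b ∈ W, ∃ u ∈ U, ∃ z ∈ Z, z ∈ V ∧ ∃ c ∈ C, a * b⁻¹ = u * z * c := by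
  obtain ⟨C, hC, hunif, hnhds⟩ := h.local_product V hV
  have hdiv : Tendsto (fun p : K × K => p.1 * p.2⁻¹) (𝓝 1 ×ˢ 𝓝 1) (𝓝 1) := by
    rw [← nhds_prod_eq]
    have : Continuous fun p : K × K => p.1 * p.2⁻¹ := by fun_prop
    simpa using this.tendsto ((1, 1) : K × K)
  obtain ⟨W, hW, hWW⟩ := Filter.mem_prod_self_iff.mp (hdiv hnhds)
  exact ⟨C, hC, W, hW, hunif W hW, fun a ha b hb => hWW (mk_mem_prod ha hb)⟩

/-- Chains of `φ` in `K` between points of `Z` project to chains in `Z`. -/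
theorem mem_chainRecurrentSet_restrict (h : HyperbolicSplitting φ S Z U) (x : Z)
    (hx : (x : K) ∈ chainRecurrentSet φ) (ψ : ℝ → Z → Z) (hψ : ∀ t z, (ψ t z : K) = φ t z) :
    x ∈ chainRecurrentSet ψ := by
  intro V hV τ hτ
  obtain ⟨V', hV', hVV⟩ := mem_nhds_subtype _ _ _ |>.mp hV
  -- The projected jump goes from `z` to `ψ_σ(z) z'` and so has error `z'⁻¹`.
  have hV'' : V'⁻¹ ∈ 𝓝 (1 : K) := by
    simpa using inv_mem_nhds_one K hV'
  obtain ⟨C, hC, W, hW, hunif, hprod⟩ := h.exists_trapping hV''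
  obtain ⟨T, hT⟩ := eventually_atTop.mp hunif
  have hch := hasChain_iff_transGen.mp (hx W hW (max T τ) (lt_max_of_lt_right hτ))
  rw [hasChain_iff_transGen]
  -- Only `φ_t(c) ∈ W` for `t ≥ T` is asked of `c`, so the step applies to the starting point, with
  -- `c = 1`, as well as to `c ∈ C`.
  have step : ∀ {a b : K}, ChainStep φ W (max T τ) a b → ∀ (u : K) (z : Z) (c : K), u ∈ U →
      (∀ t, T ≤ t → φ t c ∈ W) → a = u * z * c →
      ∃ u' ∈ U, ∃ z' : Z, ∃ c' ∈ C, b = u' * z' * c' ∧ ChainStep ψ V τ z z' := by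
    rintro a b ⟨σ, hσ, hab⟩ u z c hu hc rfl
    obtain ⟨u', hu', z', hz', hzV, c', hc', he⟩ :=
      hprod _ (hc σ ((le_max_left _ _).trans hσ)) _ hab
    obtain ⟨u'', hu'', he'⟩ := h.mul_eq hu z.2 hu' he
    refine ⟨u'', hu'', ψ σ z * ⟨z', hz'⟩, c', hc', ?_, σ, (le_max_right _ _).trans hσ, hVV ?_⟩
    · rw [Subgroup.coe_mul, hψ, ← he']
      group
    · simpa using hzV
  have key : ∀ b, Relation.TransGen (ChainStep φ W (max T τ)) (x : K) b →
      ∃ u ∈ U, ∃ z : Z, ∃ c ∈ C, b = u * z * c ∧ Relation.TransGen (ChainStep ψ V τ) x z := by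
    intro b hb
    induction hb with
    | single hb =>
      obtain ⟨u, hu, z, c, hc, he, hz⟩ := step hb 1 x 1 U.one_mem
        (fun t _ => by rw [h.flow.map_one]; exact mem_of_mem_nhds hW) (by simp)
      exact ⟨u, hu, z, c, hc, he, .single hz⟩
    | tail _ hb ih =>
      obtain ⟨u, hu, z, c, hc, he, hz⟩ := ih
      obtain ⟨u', hu', z', c', hc', he', hz'⟩ := step hb u z c hu (fun t ht => hT t ht c hc) he
      exact ⟨u', hu', z', c', hc', he', hz.tail hz'⟩
  obtain ⟨u, hu, z, c, hc, he, hz⟩ := key x hch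
  -- The chain closes up at `x ∈ Z`, and uniqueness of the factors forces `c = 1` and `u = 1`.
  have hc1 : c = 1 := h.stable_eq_one hu z.2 U.one_mem x.2 (hC hc).1 (by rw [← he, one_mul])
  rw [hc1, mul_one] at he
  have hu1 : u = 1 := h.eq_one_of_mem_central u hu (by
    rw [eq_mul_inv_iff_mul_eq.mpr he.symm]
    exact Z.mul_mem x.2 (Z.inv_mem z.2))
  rw [hu1, one_mul] at he
  rwa [← Subtype.ext he] at hz

variable [T2Space K]

/-- The right coset space `(U Z)\K` has the attractor `U Z`, whose basin contains `U Z S`. -/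
theorem stable_part_eq_one (h : HyperbolicSplitting φ S Z U) {u z s : K} (hu : u ∈ U)
    (hz : z ∈ Z) (hs : s ∈ S) (hx : u * z * s ∈ chainRecurrentSet φ) : s = 1 := by
  by_contra hne
  -- The neighbourhood `{s}ᶜ` of `1` makes `C` avoid `s`, while every chain from `u z s` with fine,
  -- long jumps ends in `U Z C`.
  obtain ⟨C, hC, W, hW, hunif, hprod⟩ :=
    h.exists_trapping (isOpen_compl_singleton.mem_nhds (Ne.symm hne) : ({s}ᶜ : Set K) ∈ 𝓝 1)
  obtain ⟨T, hT⟩ := eventually_atTop.mp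
    (hunif.and ((h.tendsto_stable s hs).eventually_mem hW))
  have hch := hasChain_iff_transGen.mp (hx W hW (max T 1) (by positivity))
  have step : ∀ {a b : K}, ChainStep φ W (max T 1) a b →
      (∃ u ∈ U, ∃ z ∈ Z, ∃ c ∈ insert s C, a = u * z * c) →
      ∃ u ∈ U, ∃ z ∈ Z, ∃ c ∈ C, b = u * z * c := by
    rintro a b ⟨σ, hσ, hab⟩ ⟨u, hu, z, hz, c, hc, rfl⟩
    have hcW : φ σ c ∈ W := by
      have := hT σ ((le_max_left _ _).trans hσ)
      rcases hc with rfl | hc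
      · exact this.2
      · exact this.1 c hc
    obtain ⟨u', hu', z', hz', -, c', hc', he⟩ := hprod _ hcW _ hab
    obtain ⟨u'', hu'', he'⟩ := h.mul_eq hu hz hu' he
    refine ⟨u'', hu'', φ σ z * z', Z.mul_mem (h.map_central σ z hz) hz', c', hc', ?_⟩
    rw [← he']
    group
  have key : ∃ u' ∈ U, ∃ z' ∈ Z, ∃ c ∈ C, u * z * s = u' * z' * c := by
    generalize hy : u * z * s = y at hch
    have : ∀ b, Relation.TransGen (ChainStep φ W (max T 1)) y b →
        ∃ u' ∈ U, ∃ z' ∈ Z, ∃ c ∈ C, b = u' * z' * c := by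
      intro b hb
      induction hb with
      | single hb => exact step hb ⟨u, hu, z, hz, s, mem_insert _ _, hy.symm⟩
      | tail _ hb ih =>
        obtain ⟨u', hu', z', hz', c, hc, rfl⟩ := ih
        exact step hb ⟨u', hu', z', hz', c, mem_insert_of_mem _ hc, rfl⟩
    exact this y hch
  obtain ⟨u', hu', z', hz', c, hc, he⟩ := key
  have hsc := h.stable_eq_one hu hz hu' hz' (S.mul_mem hs (S.inv_mem (hC hc).1))
    (by rw [← mul_assoc, he, mul_inv_cancel_right])
  exact (hC hc).2 (mul_inv_eq_one.mp hsc).symm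

/-- The forward splitting removes the `S`-factor and the reversed one the `U`-factor; what remains
is a chain recurrent point of `Z`. -/
theorem chainRecurrentSet_inter (h : HyperbolicSplitting φ S Z U)
    (h' : HyperbolicSplitting (fun t => φ (-t)) U Z S) (ψ : ℝ → Z → Z)
    (hψ : ∀ t z, (ψ t z : K) = φ t z) :
    chainRecurrentSet φ ∩ ((U : Set K) * (Z : Set K) * (S : Set K)) =
      Subtype.val '' chainRecurrentSet ψ := by
  ext x
  constructor
  · rintro ⟨hx, _, ⟨u, hu, z, hz, rfl⟩, s, hs, rfl⟩
    simp only at hx ⊢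
    obtain rfl := h.stable_part_eq_one hu hz hs hx
    rw [mul_one] at hx ⊢
    -- For the reversed flow `U` is the stable factor and must stand on the right: `u z = z (z⁻¹ u
    -- z)`.
    have hx' : 1 * z * (z⁻¹ * u * z⁻¹⁻¹) ∈ chainRecurrentSet fun t => φ (-t) := by
      have : 1 * z * (z⁻¹ * u * z⁻¹⁻¹) = u * z := by group
      rw [this]
      exact h.flow.chainRecurrentSet_subset_reverse hx
    have hu1 := h'.stable_part_eq_one S.one_mem hz (h.conj_mem _ (Z.inv_mem hz) _ hu) hx'
    have hu2 : u = 1 := by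
      rw [inv_inv, mul_assoc, inv_mul_eq_one, eq_comm] at hu1
      exact mul_eq_right.mp hu1
    rw [hu2, one_mul] at hx ⊢
    exact ⟨⟨z, hz⟩, h.mem_chainRecurrentSet_restrict ⟨z, hz⟩ hx ψ hψ, rfl⟩
  · rintro ⟨z, hz, rfl⟩
    exact ⟨mem_chainRecurrentSet_of_restrict hψ hz,
      z, ⟨1, U.one_mem, z, z.2, one_mul _⟩, 1, S.one_mem, mul_one _⟩

end HyperbolicSplitting

end TopologicalGroup

/-! ### Diagonalizability and growth of one-parameter groups of linear maps -/

section Diagonalizable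

variable {V : Type*} [AddCommGroup V] [Module ℝ V]

theorem baseChange_aeval (D : Module.End ℝ V) (p : Polynomial ℝ) :
    LinearMap.baseChange ℂ (Polynomial.aeval D p)
      = Polynomial.aeval (LinearMap.baseChange ℂ D) (p.map (algebraMap ℝ ℂ)) := by
  rw [Polynomial.aeval_map_algebraMap]
  exact (Polynomial.aeval_algHom_apply (Module.End.baseChangeHom ℝ ℂ V) D p).symm

/-- Distinct linear factors are coprime, so the kernel of the product is the sum of the kernels of
the factors. -/
theorem ker_aeval_prod_le_iSup_eigenspace (D : Module.End ℝ V) (s : Finset ℝ) :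
    LinearMap.ker (Polynomial.aeval D (∏ r ∈ s, (Polynomial.X - Polynomial.C r)))
      ≤ ⨆ r : ℝ, Module.End.eigenspace D r := by
  classical
  induction s using Finset.induction_on with
  | empty => simp [Module.End.one_eq_id]
  | insert a s ha ih =>
    rw [Finset.prod_insert ha, ← Polynomial.sup_ker_aeval_eq_ker_aeval_mul_of_coprime]
    · refine sup_le ?_ ih
      refine le_trans (le_of_eq ?_) (le_iSup _ a)
      rw [Module.End.eigenspace_def]
      simp [Algebra.algebraMap_eq_smul_one]
    · exact IsCoprime.prod_right fun r hr =>
        Polynomial.pairwise_coprime_X_sub_C Function.injective_id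
          (fun h : a = r => ha (h ▸ hr))

variable [FiniteDimensional ℝ V]

/-- The squarefree real minimal polynomial is separable, hence still squarefree over `ℂ`. -/
theorem iSup_eigenspace_baseChange_eq_top {D : Module.End ℝ V} (hD : D.IsSemisimple) :
    ⨆ μ : ℂ, Module.End.eigenspace (LinearMap.baseChange ℂ D) μ = ⊤ := by
  apply Module.End.IsSemisimple.iSup_eigenspace_eq_top
  refine Module.End.isSemisimple_of_squarefree_aeval_eq_zero
    (p := (minpoly ℝ D).map (algebraMap ℝ ℂ)) ?_ ?_
  · exact (PerfectField.separable_iff_squarefree.mpr hD.minpoly_squarefree).map.squarefree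
  · rw [← baseChange_aeval, minpoly.aeval, LinearMap.baseChange_zero]

/-- The product of `X - Re μ` over the complex eigenvalues `μ` kills every complex eigenvector
because `μ = Re μ`. It therefore kills the complexification, and so `V`, which embeds in it. -/
theorem IsHyperbolic.iSup_eigenspace_eq_top {D : Module.End ℝ V} (hD : IsHyperbolic D) :
    ⨆ r : ℝ, Module.End.eigenspace D r = ⊤ := by
  classical
  let s : Finset ℝ :=
    (Module.End.finite_hasEigenvalue (f := LinearMap.baseChange ℂ D)).toFinset.image Complex.re
  refine top_le_iff.mp (le_trans ?_ (ker_aeval_prod_le_iSup_eigenspace D s))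
  have hzero : LinearMap.baseChange ℂ
      (Polynomial.aeval D (∏ r ∈ s, (Polynomial.X - Polynomial.C r))) = 0 := by
    rw [baseChange_aeval, ← LinearMap.ker_eq_top, ← top_le_iff,
      ← iSup_eigenspace_baseChange_eq_top hD.1]
    refine iSup_le fun μ w hw => ?_
    rw [LinearMap.mem_ker]
    by_cases h0 : w = 0
    · rw [h0, map_zero]
    have hev : Module.End.HasEigenvector (LinearMap.baseChange ℂ D) μ w := ⟨hw, h0⟩
    have hμ : Module.End.HasEigenvalue (LinearMap.baseChange ℂ D) μ :=
      Module.End.hasEigenvalue_of_hasEigenvector hev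
    rw [Module.End.aeval_apply_of_hasEigenvector hev, Polynomial.map_prod, Polynomial.eval_prod,
      Finset.prod_eq_zero (i := μ.re), zero_smul]
    · exact Finset.mem_image_of_mem _ (by simpa using hμ)
    · simp only [Polynomial.map_sub, Polynomial.map_X, Polynomial.map_C, Polynomial.eval_sub,
        Polynomial.eval_X, Polynomial.eval_C, Complex.coe_algebraMap]
      exact sub_eq_zero.mpr (Complex.ext (by simp) (by simp [hD.2 μ hμ]))
  intro v _
  rw [LinearMap.mem_ker]
  have h := LinearMap.congr_fun hzero (1 ⊗ₜ[ℝ] v)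
  rw [LinearMap.baseChange_tmul, LinearMap.zero_apply] at h
  exact Module.FaithfullyFlat.tensorProduct_mk_injective (A := ℝ) (B := ℂ) V
    (h.trans (TensorProduct.tmul_zero _ _).symm)

end Diagonalizable

/-! ### Growth of linear flows: eigenvectors, nilpotent and elliptic generators -/

section Growth

variable {E : Type*} [NormedAddCommGroup E] [NormedSpace ℝ E]

/-- A one-parameter group `A` of linear maps with generator `D`. -/
structure IsLinearFlow (A : ℝ → E →L[ℝ] E) (D : E →L[ℝ] E) : Prop where
  map_zero : A 0 = 1
  hasDerivAt : ∀ t, HasDerivAt A (A t * D) t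

namespace IsLinearFlow

variable {A : ℝ → E →L[ℝ] E} {D : E →L[ℝ] E}

theorem hasDerivAt_apply (h : IsLinearFlow A D) (X : E) (t : ℝ) :
    HasDerivAt (fun t => A t X) (A t (D X)) t :=
  (ContinuousLinearMap.apply ℝ E X).hasFDerivAt.comp_hasDerivAt t (h.hasDerivAt t)

theorem apply_eigenvector (h : IsLinearFlow A D) {X : E} {r : ℝ} (hX : D X = r • X) (t : ℝ) :
    A t X = Real.exp (r * t) • X := by
  have hd : ∀ t, HasDerivAt (fun t => Real.exp (-(r * t)) • A t X) 0 t := by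
    intro t
    have h1 : HasDerivAt (fun t => Real.exp (-(r * t))) (Real.exp (-(r * t)) * -r) t := by
      have := ((hasDerivAt_id t).const_mul r).neg.exp
      simpa using this
    have := h1.smul (h.hasDerivAt_apply X t)
    refine this.congr_deriv ?_
    rw [hX, map_smul, smul_smul, ← add_smul]
    simp
  have hc := is_const_of_deriv_eq_zero (fun t => (hd t).differentiableAt)
    (fun t => (hd t).deriv) t 0
  simp only [mul_zero, neg_zero, Real.exp_zero, one_smul, h.map_zero,
    one_apply_eq_self] at hc
  conv_rhs => rw [← hc]
  rw [smul_smul, ← Real.exp_add, add_neg_cancel, Real.exp_zero, one_smul]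

/-- Induction on `k`: the derivative of `A_t X` is `A_t (D X)`, where `D X` is killed by `D ^ k`,
and the mean value inequality raises the degree by one. -/
theorem norm_le_of_nilpotent (h : IsLinearFlow A D) (k : ℕ) {X : E} (hX : (D ^ k) X = 0) :
    ∃ C : ℝ, ∀ t, ‖A t X‖ ≤ C * (1 + |t|) ^ k := by
  induction k generalizing X with
  | zero =>
    refine ⟨0, fun t => ?_⟩
    rw [pow_zero, one_apply_eq_self] at hX
    simp [hX]
  | succ k ih =>
    obtain ⟨C, hC⟩ := ih (X := D X) (by rwa [pow_succ] at hX)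
    have hC0 : 0 ≤ C := by simpa using (norm_nonneg _).trans (hC 0)
    refine ⟨‖X‖ + C, fun t => ?_⟩
    have hmv := (convex_Icc (-|t|) |t|).norm_image_sub_le_of_norm_hasDerivWithin_le
      (f := fun t => A t X) (C := C * (1 + |t|) ^ k)
      (fun s _ => (h.hasDerivAt_apply X s).hasDerivWithinAt)
      (fun s hs => (hC s).trans (by have := abs_le.mpr hs; gcongr))
      (x := 0) (y := t) (by simp) (abs_le.mp le_rfl)
    have h1 : (1 : ℝ) ≤ (1 + |t|) ^ (k + 1) := one_le_pow₀ (by linarith [abs_nonneg t])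
    have h2 : C * (1 + |t|) ^ k * |t| ≤ C * (1 + |t|) ^ (k + 1) := by
      rw [pow_succ, ← mul_assoc]
      gcongr
      linarith
    simp only [h.map_zero, one_apply_eq_self, sub_zero, Real.norm_eq_abs] at hmv
    calc ‖A t X‖ ≤ ‖X‖ + ‖A t X - X‖ := by
          simpa using norm_add_le X (A t X - X)
      _ ≤ ‖X‖ * (1 + |t|) ^ (k + 1) + C * (1 + |t|) ^ (k + 1) := by
          refine add_le_add (le_mul_of_one_le_right (norm_nonneg _) h1) (hmv.trans h2)
      _ = _ := by ring

variable [FiniteDimensional ℝ E]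

/-- Matrix coefficients of the complexified flow against an eigenvector for a purely imaginary
eigenvalue are bounded. -/
theorem bounded_coefficient (h : IsLinearFlow A D) (hD : IsElliptic (D : Module.End ℝ E))
    (l : E →ₗ[ℝ] ℝ) (w : TensorProduct ℝ ℂ E) :
    ∃ C : ℝ, ∀ t,
      ‖TensorProduct.AlgebraTensorModule.rid ℝ ℂ ℂ
        (l.baseChange ℂ ((A t : E →ₗ[ℝ] E).baseChange ℂ w))‖ ≤ C := by
  have hw : w ∈ ⨆ μ : ℂ, Module.End.eigenspace (LinearMap.baseChange ℂ (D : Module.End ℝ E)) μ := by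
    rw [iSup_eigenspace_baseChange_eq_top hD.1]
    trivial
  induction hw using Submodule.iSup_induction' with
  | zero => exact ⟨0, by simp⟩
  | add x y _ _ hx hy =>
    obtain ⟨C, hC⟩ := hx
    obtain ⟨C', hC'⟩ := hy
    refine ⟨C + C', fun t => ?_⟩
    simp only [map_add]
    exact (norm_add_le _ _).trans (add_le_add (hC t) (hC' t))
  | mem μ w hw =>
    by_cases h0 : w = 0
    · exact ⟨0, by simp [h0]⟩
    have hre : μ.re = 0 := hD.2 μ (Module.End.hasEigenvalue_of_hasEigenvector ⟨hw, h0⟩)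
    -- As a functional of the operator, the coefficient satisfies the scalar equation `g' = μ g`;
    -- since `Re μ = 0`, its modulus is constant.
    let L : (E →L[ℝ] E) →ₗ[ℝ] ℂ :=
      { toFun := fun T => TensorProduct.AlgebraTensorModule.rid ℝ ℂ ℂ
          (l.baseChange ℂ ((T : E →ₗ[ℝ] E).baseChange ℂ w))
        map_add' := fun T T' => by
          rw [ContinuousLinearMap.toLinearMap_add, LinearMap.baseChange_add, LinearMap.add_apply,
            map_add, map_add]
        map_smul' := fun c T => by
          rw [ContinuousLinearMap.toLinearMap_smul, LinearMap.baseChange_smul,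
            LinearMap.smul_apply, LinearMap.map_smul_of_tower, RingHom.id_apply]
          exact LinearMap.map_smul_of_tower
            (TensorProduct.AlgebraTensorModule.rid ℝ ℂ ℂ).toLinearMap c _ }
    have hL : ∀ T : E →L[ℝ] E, L T = TensorProduct.AlgebraTensorModule.rid ℝ ℂ ℂ
        (l.baseChange ℂ ((T : E →ₗ[ℝ] E).baseChange ℂ w)) := fun T => rfl
    have hcomp : ∀ T : E →L[ℝ] E, L (T * D) = μ * L T := by
      intro T
      have hTD : ((T * D : E →L[ℝ] E) : E →ₗ[ℝ] E).baseChange ℂ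
          = (T : E →ₗ[ℝ] E).baseChange ℂ ∘ₗ (D : E →ₗ[ℝ] E).baseChange ℂ :=
        LinearMap.baseChange_comp (A := ℂ) (D : E →ₗ[ℝ] E) (T : E →ₗ[ℝ] E)
      rw [hL, hL, hTD, LinearMap.comp_apply, Module.End.mem_eigenspace_iff.mp hw, map_smul,
        map_smul, map_smul, smul_eq_mul]
    have hd : ∀ t, HasDerivAt (fun t => L (A t)) (μ * L (A t)) t := by
      intro t
      have := (LinearMap.toContinuousLinearMap L).hasFDerivAt.comp_hasDerivAt t (h.hasDerivAt t)
      rw [← hcomp]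
      exact this
    have hg : ∀ t : ℝ, HasDerivAt (fun t : ℝ => Complex.exp (-(μ * t)) * L (A t)) 0 t := by
      intro t
      have h1 : HasDerivAt (fun t : ℝ => Complex.exp (-(μ * t)))
          (Complex.exp (-(μ * t)) * -μ) t := by
        have := ((Complex.ofRealCLM.hasDerivAt (x := t)).const_mul μ).neg.cexp
        simpa using this
      refine (h1.mul (hd t)).congr_deriv ?_
      ring
    refine ⟨‖L (A 0)‖, fun t => ?_⟩
    have hc := is_const_of_deriv_eq_zero (fun t => (hg t).differentiableAt)
      (fun t => (hg t).deriv) t 0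
    have hn := congrArg norm hc
    rw [norm_mul, norm_mul, Complex.norm_exp, Complex.norm_exp] at hn
    simp only [Complex.neg_re, Complex.mul_re, hre, zero_mul, Complex.ofReal_im, mul_zero,
      sub_zero, neg_zero, Real.exp_zero, one_mul] at hn
    rw [← hL, hn]

theorem bounded_of_isElliptic (h : IsLinearFlow A D) (hD : IsElliptic (D : Module.End ℝ E)) :
    ∃ C : ℝ, ∀ t, ‖A t‖ ≤ C := by
  refine banach_steinhaus fun X => ?_
  let b := Module.finBasis ℝ E
  have hb : ∀ i, ∃ C : ℝ, ∀ t, ‖b.coord i (A t X)‖ ≤ C := by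
    intro i
    obtain ⟨C, hC⟩ := h.bounded_coefficient hD (b.coord i) (1 ⊗ₜ[ℝ] X)
    exact ⟨C, fun t => by simpa using hC t⟩
  choose C hC using hb
  refine ⟨∑ i, C i * ‖b i‖, fun t => ?_⟩
  rw [← b.sum_repr (A t X)]
  refine norm_sum_le_of_le _ fun i _ => ?_
  rw [norm_smul]
  exact mul_le_mul_of_nonneg_right (hC i t) (norm_nonneg _)

/-- A bounded factor times a polynomially growing one is beaten by `exp (-a|t|)`. The filter `l`
allows both time directions. -/
theorem tendsto_smul_of_isElliptic_of_isNilpotent {A' : ℝ → E →L[ℝ] E} {D' : E →L[ℝ] E}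
    (h : IsLinearFlow A D) (hD : IsElliptic (D : Module.End ℝ E)) (h' : IsLinearFlow A' D')
    (hD' : IsNilpotent (D' : Module.End ℝ E)) {a : ℝ} (ha : 0 < a) {l : Filter ℝ}
    (hl : Tendsto (fun t => |t|) l atTop) (X : E) :
    Tendsto (fun t => Real.exp (-(a * |t|)) • A t (A' t X)) l (𝓝 0) := by
  obtain ⟨C, hC⟩ := h.bounded_of_isElliptic hD
  obtain ⟨k, hk⟩ := hD'
  obtain ⟨C', hC'⟩ := h'.norm_le_of_nilpotent k (X := X) (by
    have h1 : ((D' ^ k : E →L[ℝ] E) : E →ₗ[ℝ] E) = (D' : Module.End ℝ E) ^ k :=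
      map_pow (ContinuousLinearMap.toLinearMapRingHom : (E →L[ℝ] E) →+* (E →ₗ[ℝ] E)) D' k
    exact LinearMap.congr_fun (h1.trans hk) X)
  have hC0 : 0 ≤ C := (norm_nonneg _).trans (hC 0)
  have hlim : Tendsto (fun s : ℝ => C * C' * 2 ^ k * (s ^ k * Real.exp (-(a * s)))) atTop (𝓝 0) := by
    have := (isLittleO_pow_exp_pos_mul_atTop k ha).tendsto_div_nhds_zero
    have h2 := this.const_mul (C * C' * 2 ^ k)
    simpa [Real.exp_neg, div_eq_mul_inv] using h2
  refine squeeze_zero_norm' ?_ (hlim.comp hl)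
  filter_upwards [hl.eventually_ge_atTop 1] with t ht
  have hC'0 : 0 ≤ C' := by
    have := (norm_nonneg _).trans (hC' 0)
    simpa using this
  have hb : (1 + |t|) ^ k ≤ 2 ^ k * |t| ^ k := by
    rw [← mul_pow]
    gcongr
    linarith
  calc ‖Real.exp (-(a * |t|)) • A t (A' t X)‖
      = Real.exp (-(a * |t|)) * ‖A t (A' t X)‖ := by
        rw [norm_smul, Real.norm_eq_abs, Real.abs_exp]
    _ ≤ Real.exp (-(a * |t|)) * (C * (C' * (2 ^ k * |t| ^ k))) := by
        gcongr
        refine (A t).le_of_opNorm_le_of_le (hC t) ((hC' t).trans ?_)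
        gcongr
    _ = _ := by
        simp only [Function.comp]
        ring

end IsLinearFlow

end Growth

/-! ### Calculus in the chart at the identity of a Lie group -/

section IdentityChart

variable {E : Type*} [NormedAddCommGroup E]
  {G : Type*} [TopologicalSpace G] [ChartedSpace E G] [Group G]

variable (E G) in
/-- The preferred chart at the identity. -/
abbrev idChart : OpenPartialHomeomorph G E := chartAt E (1 : G)

theorem one_mem_idChart_source : (1 : G) ∈ (idChart E G).source := mem_chart_source E 1

theorem idChart_source_mem_nhds : (idChart E G).source ∈ 𝓝 (1 : G) :=
  chart_source_mem_nhds E 1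

theorem idChart_one_mem_target : idChart E G 1 ∈ (idChart E G).target :=
  (idChart E G).map_source one_mem_idChart_source

theorem idChart_symm_one : (idChart E G).symm (idChart E G 1) = 1 :=
  (idChart E G).left_inv one_mem_idChart_source

theorem continuousAt_idChart_symm : ContinuousAt (idChart E G).symm (idChart E G 1) :=
  (idChart E G).continuousAt_symm idChart_one_mem_target

theorem tendsto_idChart_symm : Tendsto (idChart E G).symm (𝓝 (idChart E G 1)) (𝓝 1) := by
  have h := (continuousAt_idChart_symm (E := E) (G := G)).tendsto
  rwa [idChart_symm_one] at h

variable [NormedSpace ℝ E]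

theorem hasMFDerivAt_iff_hasDerivAt {c : ℝ → G} {t : ℝ} (hc : c t = 1) (X : E) :
    HasMFDerivAt 𝓘(ℝ, ℝ) 𝓘(ℝ, E) c t ((1 : ℝ →L[ℝ] ℝ).smulRight X : ℝ →L[ℝ] E) ↔
      ContinuousAt c t ∧ HasDerivAt (fun s => idChart E G (c s)) X t := by
  unfold HasMFDerivAt
  refine and_congr_right fun _ => ?_
  rw [hasDerivAt_iff_hasFDerivAt, ← hasFDerivWithinAt_univ]
  simp only [writtenInExtChartAt, hc, mfld_simps]
  rfl

variable [LieGroup 𝓘(ℝ, E) ∞ G]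

theorem contMDiffAt_idChart {g : G} (hg : g ∈ (idChart E G).source) :
    ContMDiffAt 𝓘(ℝ, E) 𝓘(ℝ, E) ∞ (idChart E G) g := by
  have : IsManifold 𝓘(ℝ, E) ∞ G := ContMDiffMul.toIsManifold
  exact contMDiffAt_of_mem_maximalAtlas (IsManifold.chart_mem_maximalAtlas 1) hg

theorem contMDiffAt_idChart_symm {x : E} (hx : x ∈ (idChart E G).target) :
    ContMDiffAt 𝓘(ℝ, E) 𝓘(ℝ, E) ∞ (idChart E G).symm x := by
  have : IsManifold 𝓘(ℝ, E) ∞ G := ContMDiffMul.toIsManifold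
  exact contMDiffAt_symm_of_mem_maximalAtlas (IsManifold.chart_mem_maximalAtlas 1) hx

/-- Multiplication read in the chart at the identity. -/
theorem contDiffAt_mul_idChart {x : E} (hx : x ∈ (idChart E G).target) :
    ContDiffAt ℝ ∞
      (fun p : E × E => idChart E G ((idChart E G).symm p.1 * (idChart E G).symm p.2))
      (x, idChart E G 1) := by
  rw [← contMDiffAt_iff_contDiffAt]
  have h1 : ContMDiffAt 𝓘(ℝ, E × E) 𝓘(ℝ, E) ∞
      (fun p : E × E => (idChart E G).symm p.1 * (idChart E G).symm p.2)
      (x, idChart E G 1) := by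
    refine ContMDiffAt.mul ?_ ?_
    · exact (contMDiffAt_idChart_symm hx).comp (x, idChart E G 1) contDiff_fst.contMDiff.contMDiffAt
    · exact (contMDiffAt_idChart_symm idChart_one_mem_target).comp (x, idChart E G 1)
        contDiff_snd.contMDiff.contMDiffAt
  refine ContMDiffAt.comp (x, idChart E G 1) (contMDiffAt_idChart ?_) h1
  rw [idChart_symm_one, mul_one]
  exact (idChart E G).map_target hx

/-- A flow read in the chart at the identity. -/
theorem AutFlow.contDiffAt_idChart (φ : AutFlow E G) (t : ℝ) :
    ContDiffAt ℝ ∞ (fun p : ℝ × E => idChart E G (φ p.1 ((idChart E G).symm p.2)))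
      (t, idChart E G 1) := by
  rw [← contMDiffAt_iff_contDiffAt]
  have h1 : ContMDiffAt 𝓘(ℝ, ℝ × E) (𝓘(ℝ, ℝ).prod 𝓘(ℝ, E)) ∞
      (fun p : ℝ × E => (p.1, (idChart E G).symm p.2)) (t, idChart E G 1) :=
    contDiff_fst.contMDiff.contMDiffAt.prodMk
      ((contMDiffAt_idChart_symm idChart_one_mem_target).comp (t, idChart E G 1)
        contDiff_snd.contMDiff.contMDiffAt)
  refine ContMDiffAt.comp (t, idChart E G 1) (contMDiffAt_idChart ?_)
    (φ.contMDiff'.contMDiffAt.comp (t, idChart E G 1) h1)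
  simp only [idChart_symm_one, φ.map_one]
  exact one_mem_idChart_source

/-- The displacement `g ↦ φ_s(g) g⁻¹` read in the chart at the identity. -/
theorem AutFlow.contDiffAt_displacement (φ : AutFlow E G) :
    ContDiffAt ℝ ∞ (fun p : ℝ × E => idChart E G
      (φ p.1 ((idChart E G).symm p.2) * ((idChart E G).symm p.2)⁻¹)) (0, idChart E G 1) := by
  rw [← contMDiffAt_iff_contDiffAt]
  have h2 : ContMDiffAt 𝓘(ℝ, ℝ × E) 𝓘(ℝ, E) ∞
      (fun p : ℝ × E => (idChart E G).symm p.2) (0, idChart E G 1) :=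
    (contMDiffAt_idChart_symm idChart_one_mem_target).comp (0, idChart E G 1)
      contDiff_snd.contMDiff.contMDiffAt
  have h1 : ContMDiffAt 𝓘(ℝ, ℝ × E) (𝓘(ℝ, ℝ).prod 𝓘(ℝ, E)) ∞
      (fun p : ℝ × E => (p.1, (idChart E G).symm p.2)) (0, idChart E G 1) :=
    contDiff_fst.contMDiff.contMDiffAt.prodMk h2
  refine ContMDiffAt.comp (0, idChart E G 1) (contMDiffAt_idChart ?_)
    ((φ.contMDiff'.contMDiffAt.comp (0, idChart E G 1) h1).mul h2.inv)
  simp only [idChart_symm_one, φ.map_one, inv_one, mul_one]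
  exact one_mem_idChart_source

end IdentityChart

/-! ### The differential at the identity of a flow of automorphisms -/

namespace AutFlow

variable {E : Type*} [NormedAddCommGroup E] [NormedSpace ℝ E]
  {G : Type*} [TopologicalSpace G] [ChartedSpace E G] [Group G]

/-- The differential of `φ_t` at the identity. -/
def differential (φ : AutFlow E G) (t : ℝ) : E →L[ℝ] E :=
  mfderiv 𝓘(ℝ, E) 𝓘(ℝ, E) (φ t) (1 : G)

theorem contMDiff_apply (φ : AutFlow E G) (t : ℝ) :
    ContMDiff 𝓘(ℝ, E) 𝓘(ℝ, E) ∞ (φ t) :=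
  φ.contMDiff'.comp (contMDiff_const.prodMk contMDiff_id)

theorem contMDiff_orbit (φ : AutFlow E G) (g : G) :
    ContMDiff 𝓘(ℝ, ℝ) 𝓘(ℝ, E) ∞ (fun t => φ t g) :=
  φ.contMDiff'.comp (contMDiff_id.prodMk contMDiff_const)

theorem isAutFlow (φ : AutFlow E G) : IsAutFlow φ.toFun where
  continuous := φ.contMDiff'.continuous
  map_mul := φ.map_mul'
  map_zero := φ.map_zero'
  map_add := φ.map_add'

theorem hasMFDerivAt (φ : AutFlow E G) (t : ℝ) :
    HasMFDerivAt 𝓘(ℝ, E) 𝓘(ℝ, E) (φ t) (1 : G) (φ.differential t) :=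
  ((φ.contMDiff_apply t).mdifferentiableAt (by simp)).hasMFDerivAt

theorem hasFDerivAt_idChart (φ : AutFlow E G) (t : ℝ) :
    HasFDerivAt (fun x => idChart E G (φ t ((idChart E G).symm x))) (φ.differential t)
      (idChart E G 1) := by
  have h := (φ.hasMFDerivAt t).2
  rw [← hasFDerivWithinAt_univ]
  simp only [writtenInExtChartAt, φ.map_one, mfld_simps] at h
  exact h

theorem differential_zero (φ : AutFlow E G) : φ.differential 0 = 1 := by
  have : φ.toFun 0 = id := funext φ.map_zero'
  unfold differential
  rw [this]
  exact mfderiv_id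

theorem differential_comp {φ ψ χ : AutFlow E G} {r s t : ℝ} (h : ∀ x, φ r x = ψ s (χ t x)) :
    φ.differential r = ψ.differential s * χ.differential t := by
  have h1 : HasMFDerivAt 𝓘(ℝ, E) 𝓘(ℝ, E) (ψ s) (χ t (1 : G)) (ψ.differential s) := by
    rw [χ.map_one]
    exact ψ.hasMFDerivAt s
  have h2 := h1.comp (1 : G) (χ.hasMFDerivAt t)
  rw [← (funext h : φ.toFun r = ψ.toFun s ∘ χ.toFun t)] at h2
  exact hasMFDerivAt_unique (φ.hasMFDerivAt r) h2

variable [LieGroup 𝓘(ℝ, E) ∞ G]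

/-- Joint smoothness in the chart makes `t ↦ dφ_t` differentiable at `0`; `dφ_s = dφ_t ∘ dφ_{s-t}`
transports this to every `t`. -/
theorem isLinearFlow_differential (φ : AutFlow E G) :
    IsLinearFlow φ.differential (deriv φ.differential 0) where
  map_zero := φ.differential_zero
  hasDerivAt t := by
    have h0 : DifferentiableAt ℝ φ.differential 0 := by
      have hF := φ.contDiffAt_idChart 0
      have hF' := (hF.fderiv_right (m := 1)
        (by rw [one_add_one_eq_two]; exact ENat.LEInfty.out)).differentiableAt one_ne_zero
      have h1 : DifferentiableAt ℝ (fun t : ℝ => (fderiv ℝ (fun p : ℝ × E =>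
          idChart E G (φ p.1 ((idChart E G).symm p.2))) (t, idChart E G 1)).comp
            (ContinuousLinearMap.inr ℝ ℝ E)) 0 :=
        (hF'.comp (0 : ℝ) (by fun_prop)).clm_comp (differentiableAt_const _)
      convert h1 using 1
      ext1 t
      have h2 := ((φ.contDiffAt_idChart t).differentiableAt (by simp)).hasFDerivAt.comp
        (idChart E G 1) (hasFDerivAt_prodMk_right t (idChart E G 1))
      exact (φ.hasFDerivAt_idChart t).unique h2
    have hcomp : φ.differential = fun s => φ.differential t * φ.differential (s - t) := by
      funext s
      exact differential_comp fun x => by rw [← φ.map_add', add_sub_cancel]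
    have h3 : HasDerivAt (fun s => φ.differential (s - t)) (deriv φ.differential 0) t := by
      have := h0.hasDerivAt
      rw [← sub_self t] at this
      simpa using this.comp_sub_const t t
    have h4 := h3.const_mul (φ.differential t)
    rwa [← hcomp] at h4

end AutFlow

/-! ### One-parameter subgroups -/

section OneParameter

variable {E : Type*} [NormedAddCommGroup E] [NormedSpace ℝ E]
  {G : Type*} [TopologicalSpace G] [ChartedSpace E G] [Group G]

theorem comp_one_smulRight (L : E →L[ℝ] E) (X : E) :
    L.comp ((1 : ℝ →L[ℝ] ℝ).smulRight X) = (1 : ℝ →L[ℝ] ℝ).smulRight (L X) := by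
  ext
  simp

/-- A homomorphism `γ : ℝ → G` differentiable at `0` with `γ'(0) = X`, read in the chart at
the identity. -/
structure HasGenerator (γ : ℝ → G) (X : E) : Prop where
  map_add : ∀ s t, γ (s + t) = γ s * γ t
  continuousAt_zero : ContinuousAt γ 0
  hasDerivAt_zero : HasDerivAt (fun s => idChart E G (γ s)) X 0

namespace HasGenerator

variable {γ : ℝ → G} {X : E}

theorem map_zero (h : HasGenerator γ X) : γ 0 = 1 := by
  have := h.map_add 0 0
  rw [add_zero] at this
  exact left_eq_mul.mp this

theorem hasMFDerivAt_zero (h : HasGenerator γ X) :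
    HasMFDerivAt 𝓘(ℝ, ℝ) 𝓘(ℝ, E) γ 0 ((1 : ℝ →L[ℝ] ℝ).smulRight X : ℝ →L[ℝ] E) :=
  (hasMFDerivAt_iff_hasDerivAt h.map_zero X).mpr ⟨h.continuousAt_zero, h.hasDerivAt_zero⟩

theorem comp_mul (h : HasGenerator γ X) (c : ℝ) : HasGenerator (fun s => γ (c * s)) (c • X) where
  map_add s t := by rw [mul_add, h.map_add]
  continuousAt_zero := by
    refine ContinuousAt.comp (g := γ) (f := fun s => c * s) ?_ (by fun_prop)
    rw [mul_zero]
    exact h.continuousAt_zero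
  hasDerivAt_zero := by
    have h1 : HasDerivAt (fun s => c * s) c (0 : ℝ) := by
      simpa using (hasDerivAt_id (0 : ℝ)).const_mul c
    refine HasDerivAt.scomp (0 : ℝ) (g₁ := fun s => idChart E G (γ s)) (h := fun s => c * s) ?_ h1
    rw [mul_zero]
    exact h.hasDerivAt_zero

theorem comp_flow (h : HasGenerator γ X) (φ : AutFlow E G) (t : ℝ) :
    HasGenerator (fun s => φ t (γ s)) (φ.differential t X) := by
  have hd : HasMFDerivAt 𝓘(ℝ, ℝ) 𝓘(ℝ, E) (φ t ∘ γ) 0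
      ((1 : ℝ →L[ℝ] ℝ).smulRight (φ.differential t X) : ℝ →L[ℝ] E) := by
    have h1 : HasMFDerivAt 𝓘(ℝ, E) 𝓘(ℝ, E) (φ t) (γ 0) (φ.differential t) := by
      rw [h.map_zero]
      exact φ.hasMFDerivAt t
    exact (h1.comp 0 h.hasMFDerivAt_zero).congr_mfderiv (comp_one_smulRight (E := E) _ X)
  obtain ⟨hc, hd⟩ := (hasMFDerivAt_iff_hasDerivAt (by simp [h.map_zero, φ.map_one]) _).mp hd
  exact ⟨fun s r => by rw [h.map_add, φ.map_mul'], hc, hd⟩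

end HasGenerator

theorem IsOneParameterSubgroup.hasGenerator {γ : ℝ → G} {X : E}
    (h : IsOneParameterSubgroup (E := E) γ X) : HasGenerator γ X := by
  have h0 : γ 0 = 1 := by
    have := h.map_add 0 0
    rw [add_zero] at this
    exact left_eq_mul.mp this
  have hd := ((h.contMDiff.mdifferentiableAt (by simp)) :
    MDifferentiableAt 𝓘(ℝ, ℝ) 𝓘(ℝ, E) γ 0).hasMFDerivAt
  have he : (mfderiv 𝓘(ℝ, ℝ) 𝓘(ℝ, E) γ 0 : ℝ →L[ℝ] E)
      = ((1 : ℝ →L[ℝ] ℝ).smulRight X : ℝ →L[ℝ] E) := by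
    have h1 : ((1 : ℝ →L[ℝ] ℝ).smulRight X : ℝ →L[ℝ] E) 1 = X := by simp
    exact ContinuousLinearMap.ext_ring (h.deriv_zero.trans h1.symm)
  have hd' := (hasMFDerivAt_iff_hasDerivAt h0 X).mp (hd.congr_mfderiv he)
  exact ⟨h.map_add, hd'.1, hd'.2⟩

variable [LieGroup 𝓘(ℝ, E) ∞ G]

theorem mfderiv_mul_left_mulInvariantVectorField (g h : G) (X : GroupLieAlgebra 𝓘(ℝ, E) G) :
    mfderiv 𝓘(ℝ, E) 𝓘(ℝ, E) (g * ·) h (mulInvariantVectorField X h)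
      = mulInvariantVectorField X (g * h) := by
  have hd : ∀ a b : G, MDifferentiableAt 𝓘(ℝ, E) 𝓘(ℝ, E) (a * ·) b := fun a b =>
    (contMDiff_mul_left (I := 𝓘(ℝ, E)) (n := ∞) (a := a)).mdifferentiableAt (by simp)
  have hc : (g * h * ·) = (g * ·) ∘ (h * ·) := by
    funext x
    simp [mul_assoc]
  have h1 : HasMFDerivAt 𝓘(ℝ, E) 𝓘(ℝ, E) (g * ·) (h * 1)
      (mfderiv 𝓘(ℝ, E) 𝓘(ℝ, E) (g * ·) h : E →L[ℝ] E) := by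
    rw [mul_one]
    exact (hd g h).hasMFDerivAt
  have h2 := h1.comp (1 : G) (hd h 1).hasMFDerivAt
  rw [← hc] at h2
  have h3 := hasMFDerivAt_unique (hd (g * h) 1).hasMFDerivAt h2
  exact (DFunLike.congr_fun h3 X).symm

theorem isMIntegralCurveOn_mul_left {γ : ℝ → G} {X : GroupLieAlgebra 𝓘(ℝ, E) G} {s : Set ℝ}
    (h : IsMIntegralCurveOn γ (mulInvariantVectorField X) s) (g : G) :
    IsMIntegralCurveOn (fun t => g * γ t) (mulInvariantVectorField X) s := by
  intro t ht
  have hd : MDifferentiableAt 𝓘(ℝ, E) 𝓘(ℝ, E) (g * ·) (γ t) :=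
    (contMDiff_mul_left (I := 𝓘(ℝ, E)) (n := ∞) (a := g)).mdifferentiableAt (by simp)
  have h1 := hd.hasMFDerivAt.comp_hasMFDerivWithinAt t (h t ht)
  refine h1.congr_mfderiv ?_
  rw [← mfderiv_mul_left_mulInvariantVectorField]
  exact comp_one_smulRight (E := E) _ _

theorem contMDiff_mulInvariantVectorField_one (X : GroupLieAlgebra 𝓘(ℝ, E) G) :
    ContMDiff 𝓘(ℝ, E) 𝓘(ℝ, E).tangent 1
      (fun g : G => (⟨g, mulInvariantVectorField X g⟩ : TangentBundle 𝓘(ℝ, E) G)) := by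
  have : LieGroup 𝓘(ℝ, E) (minSmoothness ℝ 3) G :=
    LieGroup.of_le (n := ∞) (by simp; exact ENat.LEInfty.out)
  exact (contMDiff_mulInvariantVectorField X).of_le (by simp)

/-- The identity `γ(s) = γ(t) γ(s - t)` transports the derivative at `0` to time `t` by a left
translation. -/
theorem HasGenerator.isMIntegralCurve {γ : ℝ → G} {X : E} (h : HasGenerator γ X) :
    IsMIntegralCurve γ (mulInvariantVectorField (I := 𝓘(ℝ, E)) (G := G) X) := by
  intro t
  have hg : γ = (fun x => γ t * x) ∘ γ ∘ fun s => s - t := by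
    funext s
    simp [← h.map_add]
  have hd : MDifferentiableAt 𝓘(ℝ, E) 𝓘(ℝ, E) (γ t * ·) (1 : G) :=
    (contMDiff_mul_left (I := 𝓘(ℝ, E)) (n := ∞) (a := γ t)).mdifferentiableAt (by simp)
  have hs : HasMFDerivAt 𝓘(ℝ, ℝ) 𝓘(ℝ, ℝ) (fun s : ℝ => s - t) t (1 : ℝ →L[ℝ] ℝ) :=
    ((hasFDerivAt_id t).sub_const t).hasMFDerivAt
  have h1 : HasMFDerivAt 𝓘(ℝ, ℝ) 𝓘(ℝ, E) γ (t - t)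
      ((1 : ℝ →L[ℝ] ℝ).smulRight X : ℝ →L[ℝ] E) := by
    rw [sub_self]
    exact h.hasMFDerivAt_zero
  have h2 : HasMFDerivAt 𝓘(ℝ, E) 𝓘(ℝ, E) (γ t * ·) (γ (t - t))
      (mfderiv 𝓘(ℝ, E) 𝓘(ℝ, E) (γ t * ·) (1 : G) : E →L[ℝ] E) := by
    rw [sub_self, h.map_zero]
    exact hd.hasMFDerivAt
  have h3 := h2.comp t (HasMFDerivAt.comp (f := fun s => s - t) t h1 hs)
  refine (h3.congr_of_eventuallyEq (Eventually.of_forall (congrFun hg))).congr_mfderiv ?_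
  exact comp_one_smulRight (E := E) _ X

variable [T2Space G]

theorem HasGenerator.unique {γ γ' : ℝ → G} {X : E} (h : HasGenerator γ X)
    (h' : HasGenerator γ' X) : γ = γ' := by
  have : IsManifold 𝓘(ℝ, E) 1 G := IsManifold.of_le (n := ∞) ENat.LEInfty.out
  exact isMIntegralCurve_Ioo_eq_of_contMDiff_boundaryless (t₀ := 0)
    (contMDiff_mulInvariantVectorField_one X) h.isMIntegralCurve h'.isMIntegralCurve
    (by rw [h.map_zero, h'.map_zero])

theorem exists_hasGenerator [CompleteSpace E] (X : E) : ∃ γ : ℝ → G, HasGenerator γ X := by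
  have : IsManifold 𝓘(ℝ, E) 1 G := IsManifold.of_le (n := ∞) ENat.LEInfty.out
  have hv := contMDiff_mulInvariantVectorField_one (E := E) (G := G) X
  obtain ⟨γ₀, h0, hγ₀⟩ :=
    exists_isMIntegralCurveAt_of_contMDiffAt_boundaryless (t₀ := 0) (hv.contMDiffAt (x := (1 : G)))
  obtain ⟨ε, hε, hγ₀⟩ := isMIntegralCurveAt_iff'.mp hγ₀
  rw [Real.ball_eq_Ioo, zero_sub, zero_add] at hγ₀
  -- Left translates of one local integral curve through `1` exist for the same time `ε` at every
  -- point, so the field is complete.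
  obtain ⟨γ, hγ0, hγ⟩ := exists_isMIntegralCurve_of_isMIntegralCurveOn hv hε
    (fun g => ⟨fun t => g * γ₀ t, by simp [h0], isMIntegralCurveOn_mul_left hγ₀ g⟩) 1
  refine ⟨γ, and_imp.mpr (HasGenerator.mk fun s t => ?_) ?_⟩
  · have h1 : IsMIntegralCurve (fun t => γ s * γ t) (mulInvariantVectorField X) :=
      isMIntegralCurve_iff_isMIntegralCurveOn.mpr
        (isMIntegralCurveOn_mul_left (hγ.isMIntegralCurveOn univ) (γ s))
    have h2 := isMIntegralCurve_Ioo_eq_of_contMDiff_boundaryless (t₀ := 0) hv (hγ.comp_add s) h1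
      (by simp [hγ0])
    have h3 := congrFun h2 t
    simp only [Function.comp] at h3
    rw [← h3, add_comm]
  · have h1 := hγ 0
    have h2 : (mulInvariantVectorField (I := 𝓘(ℝ, E)) (G := G) X (γ 0) : E) = X := by
      rw [hγ0]
      have : ((1 : G) * ·) = id := funext one_mul
      unfold mulInvariantVectorField
      rw [this, mfderiv_id]
      rfl
    exact (hasMFDerivAt_iff_hasDerivAt hγ0 X).mp
      (h1.congr_mfderiv (congrArg (fun Y : E => (1 : ℝ →L[ℝ] ℝ).smulRight Y) h2))

end OneParameter

/-! ### Estimates on one-parameter subgroups and coordinates of the second kind -/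

section Coordinates

variable {E : Type*} [NormedAddCommGroup E] [NormedSpace ℝ E]
  {G : Type*} [TopologicalSpace G] [ChartedSpace E G] [Group G]

variable (E G) in
/-- The derivative at the identity of the left translation by the point with coordinate `x`. -/
def leftDeriv (x : E) : E →L[ℝ] E :=
  fderiv ℝ (fun y => idChart E G ((idChart E G).symm x * (idChart E G).symm y)) (idChart E G 1)

variable [LieGroup 𝓘(ℝ, E) ∞ G]

theorem hasFDerivAt_leftDeriv {x : E} (hx : x ∈ (idChart E G).target) :
    HasFDerivAt (fun y => idChart E G ((idChart E G).symm x * (idChart E G).symm y))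
      (leftDeriv E G x) (idChart E G 1) := by
  have h := ((contDiffAt_mul_idChart hx).differentiableAt (by simp)).hasFDerivAt.comp
    (idChart E G 1) (hasFDerivAt_prodMk_right x (idChart E G 1))
  exact h.differentiableAt.hasFDerivAt

theorem continuousAt_leftDeriv : ContinuousAt (leftDeriv E G) (idChart E G 1) := by
  have hF := contDiffAt_mul_idChart (E := E) (G := G) idChart_one_mem_target
  have hF' := (hF.fderiv_right (m := 0) (by simp)).continuousAt
  have h1 : ContinuousAt (fun x : E => (fderiv ℝ (fun p : E × E => idChart E G
      ((idChart E G).symm p.1 * (idChart E G).symm p.2)) (x, idChart E G 1)).comp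
        (ContinuousLinearMap.inr ℝ E E)) (idChart E G 1) :=
    (ContinuousAt.comp (f := fun x : E => (x, idChart E G 1)) hF' (by fun_prop)).clm_comp
      continuousAt_const
  refine h1.congr ?_
  filter_upwards [(idChart E G).open_target.mem_nhds idChart_one_mem_target] with x hx
  have h2 := ((contDiffAt_mul_idChart hx).differentiableAt (by simp)).hasFDerivAt.comp
    (idChart E G 1) (hasFDerivAt_prodMk_right x (idChart E G 1))
  exact h2.unique (hasFDerivAt_leftDeriv hx)

namespace HasGenerator

variable {γ : ℝ → G} {X : E}

theorem continuous (h : HasGenerator γ X) : Continuous γ :=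
  continuous_iff_continuousAt.mpr fun t => (h.isMIntegralCurve t).continuousAt

theorem hasDerivAt (h : HasGenerator γ X) {s : ℝ} (hs : γ s ∈ (idChart E G).source) :
    HasDerivAt (fun s => idChart E G (γ s)) (leftDeriv E G (idChart E G (γ s)) X) s := by
  have h1 := hasFDerivAt_leftDeriv ((idChart E G).map_source hs)
  rw [(idChart E G).left_inv hs, ← h.map_zero] at h1
  have h2 := HasFDerivAt.comp_hasDerivAt (0 : ℝ) (f := fun r => idChart E G (γ r)) h1
    h.hasDerivAt_zero
  have h3 : HasDerivAt (fun r => idChart E G (γ (s + r)))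
      (leftDeriv E G (idChart E G (γ s)) X) (s - s) := by
    rw [sub_self]
    refine h2.congr_of_eventuallyEq ?_
    have hev : ∀ᶠ r in 𝓝 (0 : ℝ), γ r ∈ (idChart E G).source :=
      h.continuousAt_zero.eventually_mem (by rw [h.map_zero]; exact idChart_source_mem_nhds)
    filter_upwards [hev] with r hr
    simp [(idChart E G).left_inv hr, h.map_add]
  simpa using h3.comp_sub_const s s

/-- Strictness is what the surjective form of the inverse function theorem needs for products of
such curves. -/
theorem hasStrictDerivAt_zero (h : HasGenerator γ X) :
    HasStrictDerivAt (fun s => idChart E G (γ s)) X 0 := by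
  have hev : ∀ᶠ s in 𝓝 (0 : ℝ), γ s ∈ (idChart E G).source :=
    h.continuousAt_zero.eventually_mem (by rw [h.map_zero]; exact idChart_source_mem_nhds)
  have hc : ContinuousAt (fun s => leftDeriv E G (idChart E G (γ s)) X) 0 := by
    refine ContinuousAt.clm_apply ?_ continuousAt_const
    refine ContinuousAt.comp (g := leftDeriv E G) (f := fun s => idChart E G (γ s)) ?_
      h.hasDerivAt_zero.continuousAt
    rw [h.map_zero]
    exact continuousAt_leftDeriv
  have h1 := hasStrictDerivAt_of_hasDerivAt_of_continuousAt
    (hev.mono fun s hs => h.hasDerivAt hs) hc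
  rwa [← h.hasDerivAt_zero.unique h1.hasDerivAt] at h1

end HasGenerator

variable [FiniteDimensional ℝ E] [T2Space G]

/-- One-parameter subgroups with small generator stay near the identity on `[0, 1]`. -/
theorem exists_generator_bound_Icc {V : Set G} (hV : V ∈ 𝓝 1) :
    ∃ δ > 0, ∀ (γ : ℝ → G) (X : E), HasGenerator γ X → ‖X‖ < δ → ∀ s ∈ Icc (0 : ℝ) 1,
      γ s ∈ V := by
  set x₀ := idChart E G 1 with hx₀
  -- Near `1` the chart image of `γ` moves with speed at most `M ‖X‖`, so if `M ‖X‖ < r` it cannot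
  -- leave the ball of radius `r` by time `1`.
  set M : ℝ := ‖leftDeriv E G x₀‖ + 1 with hM
  have hM0 : 0 < M := by positivity
  have hev : ∀ᶠ x in 𝓝 x₀, x ∈ (idChart E G).target ∧ (idChart E G).symm x ∈ V ∧
      ‖leftDeriv E G x‖ < M := by
    refine Eventually.and ((idChart E G).open_target.mem_nhds idChart_one_mem_target)
      ((tendsto_idChart_symm.eventually_mem hV).and ?_)
    exact continuousAt_leftDeriv.norm.eventually_lt continuousAt_const (by simp [hM, hx₀])
  obtain ⟨r, hr, hball⟩ := Metric.nhds_basis_closedBall.eventually_iff.mp hev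
  refine ⟨r / M, by positivity, fun γ X h hX => ?_⟩
  have hXM : M * ‖X‖ < r := by
    rw [mul_comm]
    exact (lt_div_iff₀ hM0).mp hX
  set B : Set G := (idChart E G).symm '' Metric.closedBall x₀ r with hB
  have hBc : IsClosed B := by
    refine ((isCompact_closedBall x₀ r).image_of_continuousOn ?_).isClosed
    exact (idChart E G).continuousOn_symm.mono fun x hx => (hball hx).1
  have hBs : ∀ g, g ∈ B ↔ g ∈ (idChart E G).source ∧ idChart E G g ∈ Metric.closedBall x₀ r := by
    intro g
    constructor
    · rintro ⟨x, hx, rfl⟩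
      exact ⟨(idChart E G).map_target (hball hx).1, by rwa [(idChart E G).right_inv (hball hx).1]⟩
    · rintro ⟨hg, hx⟩
      exact ⟨_, hx, (idChart E G).left_inv hg⟩
  have hcont : ContinuousOn (fun s => M * ‖X‖ * s - ‖idChart E G (γ s) - x₀‖) (γ ⁻¹' B) := by
    refine ContinuousOn.sub (by fun_prop) (ContinuousOn.norm (ContinuousOn.sub ?_ (by fun_prop)))
    exact (idChart E G).continuousOn.comp h.continuous.continuousOn fun s hs => ((hBs _).mp hs).1
  -- Continuation argument on `[0, 1]`: the times with `γ s ∈ B` and displacement at most `M ‖X‖ s`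
  -- form a closed set that can always be extended to the right.
  set S : Set ℝ := γ ⁻¹' B ∩ (fun s => M * ‖X‖ * s - ‖idChart E G (γ s) - x₀‖) ⁻¹' Ici 0 with hS
  have hSc : IsClosed (S ∩ Icc 0 1) :=
    (hcont.preimage_isClosed_of_isClosed (hBc.preimage h.continuous) isClosed_Ici).inter
      isClosed_Icc
  have hsub : Icc (0 : ℝ) 1 ⊆ S := by
    refine hSc.Icc_subset_of_forall_mem_nhdsWithin ?_ ?_
    · refine ⟨?_, ?_⟩
      · simp only [mem_preimage, h.map_zero, hBs]
        exact ⟨one_mem_idChart_source, Metric.mem_closedBall_self hr.le⟩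
      · simp [h.map_zero, hx₀]
    · rintro s ⟨⟨hsB, hs⟩, hs0, hs1⟩
      have hsB' := (hBs _).mp hsB
      have hlt : ‖idChart E G (γ s) - x₀‖ < r := by
        have h1 : ‖idChart E G (γ s) - x₀‖ ≤ M * ‖X‖ * s := by simpa using hs
        have h2 : M * ‖X‖ * s ≤ M * ‖X‖ := mul_le_of_le_one_right (by positivity) hs1.le
        linarith
      have hopen : ∀ᶠ u in 𝓝 s, γ u ∈ B := by
        have h1 : ∀ᶠ u in 𝓝 s, γ u ∈ (idChart E G).source :=
          h.continuous.continuousAt.eventually_mem ((idChart E G).open_source.mem_nhds hsB'.1)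
        have h2 : ∀ᶠ u in 𝓝 s, ‖idChart E G (γ u) - x₀‖ < r := by
          refine ContinuousAt.eventually_lt (ContinuousAt.norm (ContinuousAt.sub ?_
            continuousAt_const)) continuousAt_const hlt
          exact (h.hasDerivAt hsB'.1).continuousAt
        filter_upwards [h1, h2] with u hu1 hu2
        exact (hBs _).mpr ⟨hu1, by rw [mem_closedBall_iff_norm]; exact hu2.le⟩
      obtain ⟨ε, hε, hεB⟩ := Metric.eventually_nhds_iff_ball.mp hopen
      filter_upwards [Ioo_mem_nhdsGT (show s < s + ε by linarith)] with u hu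
      have hmem : ∀ v ∈ Icc s u, γ v ∈ B := fun v hv => hεB v (by
        rw [Metric.mem_ball, Real.dist_eq, abs_lt]
        constructor <;> linarith [hv.1, hv.2, hu.2])
      refine ⟨hmem u (right_mem_Icc.mpr hu.1.le), ?_⟩
      have hmv := norm_image_sub_le_of_norm_deriv_le_segment' (a := s) (b := u)
        (f := fun s => idChart E G (γ s)) (C := M * ‖X‖)
        (fun v hv => (h.hasDerivAt ((hBs _).mp (hmem v hv)).1).hasDerivWithinAt)
        (fun v hv => (ContinuousLinearMap.le_of_opNorm_le _
          (hball ((hBs _).mp (hmem v ⟨hv.1, hv.2.le⟩)).2).2.2.le X))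
        u (right_mem_Icc.mpr hu.1.le)
      have h1 : ‖idChart E G (γ s) - x₀‖ ≤ M * ‖X‖ * s := by simpa using hs
      have h2 := norm_sub_le_norm_sub_add_norm_sub (idChart E G (γ u)) (idChart E G (γ s)) x₀
      simp only [mem_preimage, mem_Ici]
      nlinarith
  intro s hs
  obtain ⟨x, hx, hxs⟩ := (hsub hs).1
  rw [← hxs]
  exact (hball hx).2.1

theorem exists_generator_bound {V : Set G} (hV : V ∈ 𝓝 1) :
    ∃ δ > 0, ∀ (γ : ℝ → G) (X : E), HasGenerator γ X → ‖X‖ < δ → ∀ s : ℝ, |s| ≤ 1 → γ s ∈ V := by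
  obtain ⟨δ, hδ, H⟩ := exists_generator_bound_Icc (E := E) hV
  refine ⟨δ, hδ, fun γ X h hX s hs => ?_⟩
  -- Negative times are positive times of the reversed curve: `γ(s) = γ(sign(s) |s|)`.
  have h1 := H _ _ (h.comp_mul (SignType.sign s : ℝ)) ?_ |s| ⟨abs_nonneg s, hs⟩
  · simpa only [sign_mul_abs] using h1
  · refine lt_of_le_of_lt ?_ hX
    rw [norm_smul]
    refine mul_le_of_le_one_left (norm_nonneg _) ?_
    rcases SignType.sign s with _ | _ | _ <;> simp

end Coordinates

/-! ### Coordinates of the second kind near the identity -/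

section SecondKind

variable {G : Type*} [Group G] {ι : Type*}

/-- The ordered product `∏ γ_i(s_i)` over the list `L`. -/
def curveProd (γ : ι → ℝ → G) (L : List ι) (s : ι → ℝ) : G :=
  (L.map fun i => γ i (s i)).prod

theorem curveProd_cons (γ : ι → ℝ → G) (i : ι) (L : List ι) (s : ι → ℝ) :
    curveProd γ (i :: L) s = γ i (s i) * curveProd γ L s := by
  simp [curveProd]

theorem curveProd_append (γ : ι → ℝ → G) (L L' : List ι) (s : ι → ℝ) :
    curveProd γ (L ++ L') s = curveProd γ L s * curveProd γ L' s := by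
  simp [curveProd]

theorem curveProd_mem {γ : ι → ℝ → G} {L : List ι} {H : Subgroup G}
    (h : ∀ i ∈ L, ∀ r, γ i r ∈ H) (s : ι → ℝ) : curveProd γ L s ∈ H :=
  H.list_prod_mem fun x hx => by
    obtain ⟨i, hi, rfl⟩ := List.mem_map.mp hx
    exact h i hi _

variable {E : Type*} [NormedAddCommGroup E] [NormedSpace ℝ E] [TopologicalSpace G]
  [ChartedSpace E G] {γ : ι → ℝ → G} {X : ι → E}

theorem curveProd_zero (h : ∀ i, HasGenerator (γ i) (X i)) (L : List ι) :
    curveProd γ L 0 = 1 := by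
  simp [curveProd, (h _).map_zero]

variable [LieGroup 𝓘(ℝ, E) ∞ G]

theorem continuous_curveProd (h : ∀ i, HasGenerator (γ i) (X i)) (L : List ι) :
    Continuous (curveProd γ L) := by
  have : IsTopologicalGroup G := topologicalGroup_of_lieGroup 𝓘(ℝ, E) ∞
  exact continuous_list_prod L fun i _ => (h i).continuous.comp (continuous_apply i)

/-- The derivative of multiplication at the identity is addition. -/
theorem hasStrictFDerivAt_mul_idChart :
    HasStrictFDerivAt
      (fun p : E × E => idChart E G ((idChart E G).symm p.1 * (idChart E G).symm p.2))
      (ContinuousLinearMap.fst ℝ E E + ContinuousLinearMap.snd ℝ E E)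
      (idChart E G 1, idChart E G 1) := by
  have h := (contDiffAt_mul_idChart (E := E) (G := G) idChart_one_mem_target).hasStrictFDerivAt
    (by simp)
  have hev : ∀ᶠ x in 𝓝 (idChart E G 1), x ∈ (idChart E G).target :=
    (idChart E G).open_target.mem_nhds idChart_one_mem_target
  have h1 := HasFDerivAt.comp (f := fun x : E => (x, idChart E G 1)) (idChart E G 1) h.hasFDerivAt
    (hasFDerivAt_prodMk_left (𝕜 := ℝ) (idChart E G 1) (idChart E G 1))
  have h2 := h.hasFDerivAt.comp (idChart E G 1)
    (hasFDerivAt_prodMk_right (𝕜 := ℝ) (idChart E G 1) (idChart E G 1))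
  have h1' := h1.unique ((hasFDerivAt_id (𝕜 := ℝ) (idChart E G 1)).congr_of_eventuallyEq (by
    filter_upwards [hev] with x hx
    simp [(idChart E G).right_inv hx]))
  have h2' := h2.unique ((hasFDerivAt_id (𝕜 := ℝ) (idChart E G 1)).congr_of_eventuallyEq (by
    filter_upwards [hev] with x hx
    simp [(idChart E G).right_inv hx]))
  refine h.congr_fderiv (ContinuousLinearMap.ext fun p => ?_)
  have e1 := DFunLike.congr_fun h1' p.1
  have e2 := DFunLike.congr_fun h2' p.2
  simp only [ContinuousLinearMap.comp_apply, ContinuousLinearMap.inl_apply,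
    ContinuousLinearMap.inr_apply, ContinuousLinearMap.id_apply] at e1 e2
  rw [add_apply, ContinuousLinearMap.coe_fst', ContinuousLinearMap.coe_snd']
  conv_rhs => rw [← e1, ← e2]
  rw [← map_add]
  simp

variable [Fintype ι]

theorem hasStrictFDerivAt_curveProd (h : ∀ i, HasGenerator (γ i) (X i)) (L : List ι) :
    HasStrictFDerivAt (fun s : ι → ℝ => idChart E G (curveProd γ L s))
      (L.map fun i => (ContinuousLinearMap.proj (R := ℝ) (φ := fun _ : ι => ℝ) i).smulRight
        (X i)).sum 0 := by
  induction L with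
  | nil =>
    simp only [curveProd, List.map_nil, List.prod_nil, List.sum_nil]
    exact hasStrictFDerivAt_const _ _
  | cons i L ih =>
    have h1 : HasStrictFDerivAt (fun s : ι → ℝ => idChart E G (γ i (s i)))
        ((ContinuousLinearMap.proj (R := ℝ) (φ := fun _ : ι => ℝ) i).smulRight (X i)) 0 := by
      have := HasStrictDerivAt.hasStrictFDerivAt (h i).hasStrictDerivAt_zero
      have h2 := HasStrictFDerivAt.comp (0 : ι → ℝ) (f := fun s : ι → ℝ => s i)
        (g := fun s => idChart E G (γ i s)) this
        (ContinuousLinearMap.proj (R := ℝ) (φ := fun _ : ι => ℝ) i).hasStrictFDerivAt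
      exact h2.congr_fderiv (ContinuousLinearMap.ext fun _ => by simp)
    have hmul := hasStrictFDerivAt_mul_idChart (E := E) (G := G)
    have h2 : HasStrictFDerivAt (fun s : ι → ℝ => idChart E G
        ((idChart E G).symm (idChart E G (γ i (s i))) *
          (idChart E G).symm (idChart E G (curveProd γ L s)))) _ 0 :=
      HasStrictFDerivAt.comp (0 : ι → ℝ) (f := fun s : ι → ℝ =>
        (idChart E G (γ i (s i)), idChart E G (curveProd γ L s)))
        (by simpa only [Pi.zero_apply, (h i).map_zero, curveProd_zero h] using hmul)
        (h1.prodMk ih)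
    have h3 := h2.congr_of_eventuallyEq (f₁ := fun s : ι → ℝ =>
      idChart E G (curveProd γ (i :: L) s)) (by
        have e1 : ∀ᶠ s : ι → ℝ in 𝓝 0, γ i (s i) ∈ (idChart E G).source :=
          ((h i).continuous.comp (continuous_apply i)).continuousAt.eventually_mem
            (by simpa [(h i).map_zero] using idChart_source_mem_nhds)
        have e2 : ∀ᶠ s : ι → ℝ in 𝓝 0, curveProd γ L s ∈ (idChart E G).source :=
          (continuous_curveProd h L).continuousAt.eventually_mem
            (by simpa only [curveProd_zero h] using idChart_source_mem_nhds)
        filter_upwards [e1, e2] with s hs1 hs2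
        rw [(idChart E G).left_inv hs1, (idChart E G).left_inv hs2, curveProd_cons])
    refine h3.congr_fderiv ?_
    ext
    simp

/-- The derivative at `0` sends `s` to `∑ s_i b_i`, which is onto, so the product map is open at
`0`. -/
theorem nhds_one_le_map_curveProd [FiniteDimensional ℝ E] (b : Module.Basis ι ℝ E)
    (h : ∀ i, HasGenerator (γ i) (b i)) {L : List ι} (hL : L.Nodup) (hmem : ∀ i, i ∈ L) :
    𝓝 1 ≤ map (curveProd γ L) (𝓝 0) := by
  classical
  have hd := hasStrictFDerivAt_curveProd h L
  have hsurj : (L.map fun i => (ContinuousLinearMap.proj (R := ℝ) (φ := fun _ : ι => ℝ) i).smulRight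
      (b i)).sum.range = ⊤ := by
    refine LinearMap.range_eq_top.mpr fun e => ⟨fun i => b.repr e i, ?_⟩
    have hu : L.toFinset = Finset.univ := by
      ext i
      simp [hmem i]
    rw [← List.sum_toFinset _ hL, hu]
    simp [b.sum_repr]
  have hmap := hd.map_nhds_eq_of_surj hsurj
  rw [curveProd_zero h] at hmap
  intro A hA
  -- Keeping the products inside the chart domain lets equality of coordinates give equality in `G`.
  have hA' : curveProd γ L ⁻¹' A ∩ curveProd γ L ⁻¹' (idChart E G).source ∈ 𝓝 (0 : ι → ℝ) :=
    inter_mem hA ((continuous_curveProd h L).continuousAt.preimage_mem_nhds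
      (by rw [curveProd_zero h]; exact idChart_source_mem_nhds))
  have hI := image_mem_map (m := fun s : ι → ℝ => idChart E G (curveProd γ L s)) hA'
  rw [hmap] at hI
  have hI' := (idChart E G).continuousAt one_mem_idChart_source |>.preimage_mem_nhds hI
  filter_upwards [hI', idChart_source_mem_nhds (E := E)] with g hg hgs
  obtain ⟨s, ⟨hsA, hss⟩, hs⟩ := hg
  rwa [← (idChart E G).injOn hss hgs hs]

/-- A flow of automorphisms contracts the products of contracted one-parameter subgroups,
uniformly for bounded parameters. -/
theorem eventually_curveProd_mem [FiniteDimensional ℝ E] [T2Space G] (φ : AutFlow E G)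
    (h : ∀ i, HasGenerator (γ i) (X i)) {l : Filter ℝ} {L : List ι}
    (hX : ∀ i ∈ L, Tendsto (fun t => φ.differential t (X i)) l (𝓝 0)) {W : Set G}
    (hW : W ∈ 𝓝 1) : ∀ᶠ t in l, ∀ s : ι → ℝ, ‖s‖ ≤ 1 → φ t (curveProd γ L s) ∈ W := by
  have : IsTopologicalGroup G := topologicalGroup_of_lieGroup 𝓘(ℝ, E) ∞
  induction L generalizing W with
  | nil =>
    refine Eventually.of_forall fun t s _ => ?_
    simpa [curveProd, φ.map_one] using mem_of_mem_nhds hW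
  | cons i L ih =>
    obtain ⟨W', hW', hWW⟩ := exists_nhds_one_split hW
    obtain ⟨δ, hδ, hb⟩ := exists_generator_bound (E := E) hW'
    filter_upwards [ih (fun j hj => hX j (List.mem_cons_of_mem _ hj)) hW',
      (hX i List.mem_cons_self).norm.eventually_lt_const (by simpa using hδ)] with t ht ht' s hs
    rw [curveProd_cons, φ.map_mul']
    -- The curve `φ_t ∘ γ_i` is generated by `dφ_t X_i`, which is small, so it stays near `1` for
    -- parameters in `[-1, 1]`.
    refine hWW _ (hb _ _ ((h i).comp_flow φ t) ht' (s i) ?_) _ (ht s hs)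
    exact (norm_le_pi_norm s i).trans hs

end SecondKind

/-! ### Contracted and fixed subgroups -/

namespace IsAutFlow

variable {K : Type*} [Group K] [TopologicalSpace K] {φ : ℝ → K → K}

/-- The fixed points of a flow of automorphisms. -/
def fixedSubgroup (hφ : IsAutFlow φ) : Subgroup K where
  carrier := {g | ∀ t, φ t g = g}
  mul_mem' ha hb t := by rw [hφ.map_mul, ha, hb]
  one_mem' t := hφ.map_one t
  inv_mem' ha t := by rw [hφ.map_inv, ha]

theorem mem_fixedSubgroup (hφ : IsAutFlow φ) {g : K} : g ∈ hφ.fixedSubgroup ↔ ∀ t, φ t g = g :=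
  Iff.rfl

theorem fixedSubgroup_reverse (hφ : IsAutFlow φ) :
    hφ.reverse.fixedSubgroup = hφ.fixedSubgroup := by
  ext g
  simp only [mem_fixedSubgroup]
  exact ⟨fun h t => by simpa using h (-t), fun h t => h (-t)⟩

theorem map_mem_fixedSubgroup (hφ : IsAutFlow φ) {f : K → K} (hf : ∀ t x, φ t (f x) = f (φ t x))
    {g : K} (hg : g ∈ hφ.fixedSubgroup) : f g ∈ hφ.fixedSubgroup := fun t => by
  rw [hf, hg t]

variable [IsTopologicalGroup K]

/-- The points converging to `1` along the filter `l`. -/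
def contractedSubgroup (hφ : IsAutFlow φ) (l : Filter ℝ) : Subgroup K where
  carrier := {g | Tendsto (fun t => φ t g) l (𝓝 1)}
  mul_mem' {a b} ha hb := by
    have := Tendsto.mul (mem_ofPred.mp ha) (mem_ofPred.mp hb)
    simpa only [mem_ofPred, hφ.map_mul, mul_one] using this
  one_mem' := by simpa only [mem_ofPred, hφ.map_one] using tendsto_const_nhds
  inv_mem' {a} ha := by
    have := Tendsto.inv (mem_ofPred.mp ha)
    simpa only [mem_ofPred, hφ.map_inv, inv_one] using this

theorem mem_contractedSubgroup (hφ : IsAutFlow φ) {l : Filter ℝ} {g : K} :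
    g ∈ hφ.contractedSubgroup l ↔ Tendsto (fun t => φ t g) l (𝓝 1) :=
  Iff.rfl

theorem contractedSubgroup_reverse_atTop (hφ : IsAutFlow φ) :
    hφ.reverse.contractedSubgroup atTop = hφ.contractedSubgroup atBot := by
  ext g
  simp only [mem_contractedSubgroup]
  exact ⟨fun h => by simpa [Function.comp_def] using h.comp tendsto_neg_atBot_atTop,
    fun h => h.comp tendsto_neg_atTop_atBot⟩

theorem contractedSubgroup_reverse_atBot (hφ : IsAutFlow φ) :
    hφ.reverse.contractedSubgroup atBot = hφ.contractedSubgroup atTop := by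
  ext g
  simp only [mem_contractedSubgroup]
  exact ⟨fun h => by simpa [Function.comp_def] using h.comp tendsto_neg_atTop_atBot,
    fun h => h.comp tendsto_neg_atBot_atTop⟩

theorem map_mem_contractedSubgroup (hφ : IsAutFlow φ) {f : K → K} (hfc : Continuous f)
    (hf1 : f 1 = 1) (hf : ∀ t x, φ t (f x) = f (φ t x)) {l : Filter ℝ} {g : K}
    (hg : g ∈ hφ.contractedSubgroup l) : f g ∈ hφ.contractedSubgroup l := by
  rw [mem_contractedSubgroup] at hg ⊢
  have := (hfc.tendsto 1).comp hg
  rw [hf1] at this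
  simpa only [hf, Function.comp_def] using this

end IsAutFlow

namespace AutFlow

variable {E : Type*} [NormedAddCommGroup E] [NormedSpace ℝ E]
  {G : Type*} [TopologicalSpace G] [ChartedSpace E G] [Group G]

/-- The time-reversed flow. -/
def reverse (φ : AutFlow E G) : AutFlow E G where
  toFun t := φ (-t)
  contMDiff' := φ.contMDiff'.comp
    ((contDiff_neg.contMDiff.comp contMDiff_fst).prodMk contMDiff_snd)
  map_mul' t := φ.map_mul' (-t)
  map_zero' x := by rw [neg_zero, φ.map_zero']
  map_add' s t x := by rw [neg_add, φ.map_add']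

theorem reverse_differential (φ : AutFlow E G) (t : ℝ) :
    φ.reverse.differential t = φ.differential (-t) := rfl

/-! ### The velocity of a flow of automorphisms -/

/-- The velocity at time `0` of the displacement `s ↦ φ_s(g) g⁻¹`. -/
def velocity (φ : AutFlow E G) (g : G) : E :=
  deriv (fun s => idChart E G (φ s g * g⁻¹)) 0

theorem velocity_mul_of_fixed (φ : AutFlow E G) (g : G) {z : G} (hz : ∀ t, φ t z = z) :
    φ.velocity (g * z) = φ.velocity g := by
  simp only [velocity, φ.map_mul', hz, mul_inv_rev, mul_assoc, mul_inv_cancel_left]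

variable [LieGroup 𝓘(ℝ, E) ∞ G]

theorem contMDiff_displacement (φ : AutFlow E G) (g : G) :
    ContMDiff 𝓘(ℝ, ℝ) 𝓘(ℝ, E) ∞ (fun s => φ s g * g⁻¹) :=
  (φ.contMDiff_orbit g).mul contMDiff_const

theorem hasDerivAt_velocity (φ : AutFlow E G) (g : G) :
    HasDerivAt (fun s => idChart E G (φ s g * g⁻¹)) (φ.velocity g) 0 := by
  refine DifferentiableAt.hasDerivAt ?_
  have h : ContMDiffAt 𝓘(ℝ, ℝ) 𝓘(ℝ, E) ∞ (fun s => idChart E G (φ s g * g⁻¹)) 0 := by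
    refine ContMDiffAt.comp (0 : ℝ) (contMDiffAt_idChart ?_)
      (φ.contMDiff_displacement g).contMDiffAt
    rw [φ.map_zero', mul_inv_cancel]
    exact one_mem_idChart_source
  exact (contMDiffAt_iff_contDiffAt.mp h).differentiableAt (by simp)

/-- Differentiate `φ_s(φ_t g) (φ_t g)⁻¹ = φ_t(φ_s(g) g⁻¹)` at `s = 0`. -/
theorem velocity_apply (φ : AutFlow E G) (t : ℝ) (g : G) :
    φ.velocity (φ t g) = φ.differential t (φ.velocity g) := by
  have h1 := φ.hasFDerivAt_idChart t
  have h0 : φ 0 g * g⁻¹ = 1 := by rw [φ.map_zero', mul_inv_cancel]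
  rw [← h0] at h1
  have h2 := HasFDerivAt.comp_hasDerivAt (0 : ℝ) (f := fun s => idChart E G (φ s g * g⁻¹)) h1
    (φ.hasDerivAt_velocity g)
  refine ((φ.hasDerivAt_velocity (φ t g)).unique (h2.congr_of_eventuallyEq ?_))
  have hev : ∀ᶠ s in 𝓝 (0 : ℝ), φ s g * g⁻¹ ∈ (idChart E G).source :=
    (φ.contMDiff_displacement g).continuous.continuousAt.eventually_mem
      (by rw [h0]; exact idChart_source_mem_nhds)
  filter_upwards [hev] with s hs
  simp only [Function.comp, (idChart E G).left_inv hs]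
  rw [φ.map_mul', φ.map_inv, ← φ.map_add', ← φ.map_add', add_comm]

/-- In the chart the velocity is a partial derivative of the smooth displacement map, hence
continuous near `1`, and it vanishes at the fixed point `1`. -/
theorem tendsto_velocity (φ : AutFlow E G) : Tendsto φ.velocity (𝓝 1) (𝓝 0) := by
  set F : ℝ × E → E := fun p => idChart E G
    (φ p.1 ((idChart E G).symm p.2) * ((idChart E G).symm p.2)⁻¹) with hF
  have hFd : ContDiffAt ℝ ∞ F (0, idChart E G 1) := φ.contDiffAt_displacement
  have hF' := (hFd.fderiv_right (m := 0) (by simp)).continuousAt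
  have hdiff : ∀ᶠ p in 𝓝 ((0 : ℝ), idChart E G 1), DifferentiableAt ℝ F p :=
    (hFd.of_le (m := 1) ENat.LEInfty.out).eventually (by simp) |>.mono
      fun p hp => hp.differentiableAt (by simp)
  have hι : Tendsto (fun g : G => ((0 : ℝ), idChart E G g)) (𝓝 1) (𝓝 (0, idChart E G 1)) :=
    tendsto_const_nhds.prodMk_nhds ((idChart E G).continuousAt one_mem_idChart_source)
  have hd : ∀ x, DifferentiableAt ℝ F (0, x) →
      HasDerivAt (fun s : ℝ => F (s, x)) (fderiv ℝ F (0, x) (1, 0)) 0 := fun x hx =>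
    HasFDerivAt.comp_hasDerivAt (0 : ℝ) (f := fun s : ℝ => (s, x)) hx.hasFDerivAt
      ((hasDerivAt_id (0 : ℝ)).prodMk (hasDerivAt_const _ _))
  have hval : fderiv ℝ F (0, idChart E G 1) (1, 0) = 0 := by
    refine (hd _ (hFd.differentiableAt (by simp))).unique ?_
    simp only [hF, idChart_symm_one, φ.map_one]
    exact hasDerivAt_const _ _
  have hlim : Tendsto (fun g : G => fderiv ℝ F (0, idChart E G g) (1, 0)) (𝓝 1) (𝓝 0) := by
    have h := ((ContinuousLinearMap.apply ℝ E ((1 : ℝ), (0 : E))).continuous.tendsto _).comp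
      (hF'.tendsto.comp hι)
    rwa [ContinuousLinearMap.apply_apply, hval] at h
  refine hlim.congr' ?_
  filter_upwards [hι.eventually hdiff, idChart_source_mem_nhds (E := E)] with g hg hgs
  refine (hd _ hg).unique ?_
  simp only [hF, (idChart E G).left_inv hgs]
  exact φ.hasDerivAt_velocity g

variable [T2Space G]

/-- Right translation of the displacement shows that the orbit has zero derivative everywhere;
uniqueness of integral curves of the zero field makes it constant. -/
theorem apply_eq_self_of_velocity_eq_zero (φ : AutFlow E G) {g : G}
    (h : ∀ t, φ.velocity (φ t g) = 0) (t : ℝ) : φ t g = g := by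
  have : IsManifold 𝓘(ℝ, E) 1 G := IsManifold.of_le (n := ∞) ENat.LEInfty.out
  have hzero : ∀ x : G, (mulInvariantVectorField (I := 𝓘(ℝ, E)) (G := G) (0 : E) x : E) = 0 :=
    fun x => map_zero (mfderiv 𝓘(ℝ, E) 𝓘(ℝ, E) (x * ·) (1 : G))
  have hs0 : (1 : ℝ →L[ℝ] ℝ).smulRight (0 : E) = 0 := by
    ext
    simp
  have h1 : IsMIntegralCurve (fun t => φ t g)
      (mulInvariantVectorField (I := 𝓘(ℝ, E)) (G := G) (0 : E)) := by
    intro t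
    have hk : HasMFDerivAt 𝓘(ℝ, ℝ) 𝓘(ℝ, E) (fun s => φ s (φ t g) * (φ t g)⁻¹) (t - t)
        (0 : ℝ →L[ℝ] E) := by
      rw [sub_self, ← hs0, hasMFDerivAt_iff_hasDerivAt (by rw [φ.map_zero', mul_inv_cancel])]
      exact ⟨(φ.contMDiff_displacement _).continuous.continuousAt,
        h t ▸ φ.hasDerivAt_velocity (φ t g)⟩
    have hs : HasMFDerivAt 𝓘(ℝ, ℝ) 𝓘(ℝ, ℝ) (fun s : ℝ => s - t) t (1 : ℝ →L[ℝ] ℝ) :=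
      ((hasFDerivAt_id t).sub_const t).hasMFDerivAt
    have hR : ∀ x, MDifferentiableAt 𝓘(ℝ, E) 𝓘(ℝ, E) (· * φ t g) x := fun x =>
      (contMDiff_mul_right (I := 𝓘(ℝ, E)) (n := ∞) (a := φ t g)).mdifferentiableAt (by simp)
    have h3 := (hR _).hasMFDerivAt.comp t (HasMFDerivAt.comp (f := fun s => s - t) t hk hs)
    refine (h3.congr_of_eventuallyEq (Eventually.of_forall fun s => ?_)).congr_mfderiv ?_
    · simp [← φ.map_add']
    · have e : ∀ L : E →L[ℝ] E, L.comp ((0 : ℝ →L[ℝ] E).comp (1 : ℝ →L[ℝ] ℝ))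
          = (1 : ℝ →L[ℝ] ℝ).smulRight (0 : E) := fun L => by simp [hs0]
      exact (e _).trans
        (congrArg (fun Y : E => (1 : ℝ →L[ℝ] ℝ).smulRight Y) (hzero (φ t g)).symm)
  have h2 : IsMIntegralCurve (fun _ : ℝ => g)
      (mulInvariantVectorField (I := 𝓘(ℝ, E)) (G := G) (0 : E)) := by
    intro t
    refine (hasMFDerivAt_const (I := 𝓘(ℝ, ℝ)) g t).congr_mfderiv ?_
    exact hs0.symm.trans (congrArg (fun Y : E => (1 : ℝ →L[ℝ] ℝ).smulRight Y) (hzero g).symm)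
  have h3 := isMIntegralCurve_Ioo_eq_of_contMDiff_boundaryless (t₀ := 0)
    (contMDiff_mulInvariantVectorField_one (0 : E)) h1 h2 (φ.map_zero' g)
  exact congrFun h3 t

end AutFlow

/-! ### The hyperbolic splitting of a Lie group -/

namespace AutFlow

variable {E : Type*} [NormedAddCommGroup E] [NormedSpace ℝ E]
  {G : Type*} [TopologicalSpace G] [ChartedSpace E G] [Group G] [LieGroup 𝓘(ℝ, E) ∞ G]
  [T2Space G] {ι : Type*} [Fintype ι]

theorem apply_eq_of_eigenvector (φ : AutFlow E G) {γ : ℝ → G} {X : E} (h : HasGenerator γ X)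
    {t c : ℝ} (hX : φ.differential t X = c • X) (s : ℝ) : φ t (γ s) = γ (c * s) :=
  congrFun ((h.comp_flow φ t).unique (hX ▸ h.comp_mul c)) s

variable [FiniteDimensional ℝ E]

/-- A point attracted to the identity in the future, and to a fixed point in the past, is the
identity. -/
theorem eq_one_of_tendsto (φ : AutFlow E G) (b : Module.Basis ι ℝ E) {r : ι → ℝ}
    (hr : ∀ i t, φ.differential t (b i) = Real.exp (r i * t) • b i) {u z : G}
    (hu : Tendsto (fun t => φ t u) atBot (𝓝 1)) (hz : ∀ t, φ t z = z)
    (huz : Tendsto (fun t => φ t (u * z)) atTop (𝓝 1)) : u * z = 1 := by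
  have hcoord : ∀ i t X, b.repr (φ.differential t X) i = Real.exp (r i * t) * b.repr X i := by
    intro i t X
    conv_lhs => rw [← b.sum_repr X]
    simp only [map_sum, map_smul, hr, Finsupp.coe_finsetSum, Finset.sum_apply, Finsupp.smul_apply,
      b.repr_self, smul_eq_mul]
    rw [Finset.sum_eq_single i (fun j _ hj => by simp [Finsupp.single_eq_of_ne hj.symm])
      (by simp)]
    simp [mul_comm]
  have hrepr : ∀ i, Continuous fun X : E => b.repr X i := fun i =>
    (b.coord i).continuous_of_finiteDimensional
  set v := φ.velocity u with hv
  -- The velocity does not see the fixed factor `z`, so the future of `u z` and the past of `u`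
  -- constrain the same vector `v`.
  have htop : Tendsto (fun t => φ.differential t v) atTop (𝓝 0) := by
    have h1 := φ.tendsto_velocity.comp huz
    simpa only [Function.comp_def, velocity_apply, velocity_mul_of_fixed φ u hz] using h1
  have hbot : Tendsto (fun t => φ.differential t v) atBot (𝓝 0) := by
    have h1 := φ.tendsto_velocity.comp hu
    simpa only [Function.comp_def, velocity_apply] using h1
  have hv0 : v = 0 := by
    refine b.repr.map_eq_zero_iff.mp (Finsupp.ext fun i => ?_)
    have ht := ((hrepr i).tendsto 0).comp htop
    have hb := ((hrepr i).tendsto 0).comp hbot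
    simp only [Function.comp_def, hcoord, map_zero, Finsupp.coe_zero, Pi.zero_apply] at ht hb
    -- Both factors tend to `0`, yet the exponentials at `t` and `-t` cancel and leave the constant
    -- square of the `i`-th coordinate of `v`.
    have hprod := ht.mul (hb.comp tendsto_neg_atTop_atBot)
    have hconst : ∀ t : ℝ, Real.exp (r i * t) * b.repr v i * (Real.exp (r i * -t) * b.repr v i)
        = b.repr v i * b.repr v i := fun t => by
      rw [mul_mul_mul_comm, ← Real.exp_add, mul_neg, add_neg_cancel, Real.exp_zero, one_mul]
    simp only [Function.comp_def, hconst, mul_zero] at hprod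
    exact mul_self_eq_zero.mp (tendsto_nhds_unique tendsto_const_nhds hprod)
  have hfix : ∀ t, φ t (u * z) = u * z := φ.apply_eq_self_of_velocity_eq_zero fun t => by
    rw [velocity_apply, velocity_mul_of_fixed φ u hz, ← hv, hv0, map_zero]
  simp only [hfix] at huz
  exact tendsto_nhds_unique tendsto_const_nhds huz

/-- Here `ψ` is the hyperbolic part of `φ`. All three subgroups are defined through `ψ`, so every
flow commuting with it preserves them; sorting the eigenbasis by the sign of `r i` orders the
coordinates as `U`, `Z`, `S`. -/
theorem hyperbolicSplitting [IsTopologicalGroup G] (φ ψ : AutFlow E G)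
    (hcomm : ∀ s t x, ψ s (φ t x) = φ t (ψ s x)) (b : Module.Basis ι ℝ E) {r : ι → ℝ}
    (hr : ∀ i t, ψ.differential t (b i) = Real.exp (r i * t) • b i)
    (hstable : ∀ i, r i < 0 → Tendsto (fun t => φ.differential t (b i)) atTop (𝓝 0)) :
    HyperbolicSplitting φ.toFun (ψ.isAutFlow.contractedSubgroup atTop) ψ.isAutFlow.fixedSubgroup
      (ψ.isAutFlow.contractedSubgroup atBot) := by
  classical
  choose γ hγ using fun i => exists_hasGenerator (G := G) (b i)
  have hscale : ∀ i t s, ψ t (γ i s) = γ i (Real.exp (r i * t) * s) := fun i t s =>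
    ψ.apply_eq_of_eigenvector (hγ i) (hr i t) s
  have hcontr : ∀ (l : Filter ℝ) i, Tendsto (fun t => r i * t) l atBot →
      ∀ s, γ i s ∈ ψ.isAutFlow.contractedSubgroup l := by
    intro l i hl s
    rw [IsAutFlow.mem_contractedSubgroup]
    have h1 : Tendsto (fun t => Real.exp (r i * t) * s) l (𝓝 0) := by
      simpa using (Real.tendsto_exp_atBot.comp hl).mul_const s
    have h2 := ((hγ i).continuous.tendsto 0).comp h1
    rw [(hγ i).map_zero] at h2
    simpa only [Function.comp_def, hscale] using h2
  set Lp : List ι := Finset.univ.toList.filter fun i => 0 < r i with hLp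
  set Lz : List ι := Finset.univ.toList.filter fun i => r i = 0 with hLz
  set Ln : List ι := Finset.univ.toList.filter fun i => r i < 0 with hLn
  have hmemp : ∀ s, curveProd γ Lp s ∈ ψ.isAutFlow.contractedSubgroup atBot :=
    curveProd_mem fun i hi => hcontr _ i
      (tendsto_id.const_mul_atBot (by simpa [hLp] using hi))
  have hmemz : ∀ s, curveProd γ Lz s ∈ ψ.isAutFlow.fixedSubgroup :=
    curveProd_mem fun i hi s t => by
      have h0 : r i = 0 := by simpa [hLz] using hi
      rw [hscale, h0, zero_mul, Real.exp_zero, one_mul]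
  have hmemn : ∀ s, curveProd γ Ln s ∈ ψ.isAutFlow.contractedSubgroup atTop :=
    curveProd_mem fun i hi => hcontr _ i
      (tendsto_id.const_mul_atTop_of_neg (by simpa [hLn] using hi))
  have hnodup : (Lp ++ (Lz ++ Ln)).Nodup := by
    have hd := Finset.nodup_toList (Finset.univ : Finset ι)
    rw [List.nodup_append', List.nodup_append']
    refine ⟨hd.filter _, ⟨hd.filter _, hd.filter _, ?_⟩, ?_⟩
    · intro i h1 h2
      simp [hLz, hLn] at h1 h2
      linarith
    · intro i h1 h2
      simp [hLp, hLz, hLn] at h1 h2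
      rcases h2 with h2 | h2 <;> linarith
  have hall : ∀ i, i ∈ Lp ++ (Lz ++ Ln) := by
    intro i
    simp only [hLp, hLz, hLn, List.mem_append, List.mem_filter, Finset.mem_toList,
      Finset.mem_univ, true_and, decide_eq_true_eq]
    rcases lt_trichotomy (r i) 0 with h | h | h <;> tauto
  have hnhds := nhds_one_le_map_curveProd b hγ hnodup hall
  have hunif : ∀ W ∈ 𝓝 (1 : G), ∀ᶠ t in atTop, ∀ s : ι → ℝ, ‖s‖ ≤ 1 →
      φ t (curveProd γ Ln s) ∈ W := fun W hW =>
    eventually_curveProd_mem φ hγ (fun i hi => hstable i (by simpa [hLn] using hi)) hW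
  have hdisj : ∀ u ∈ ψ.isAutFlow.contractedSubgroup atBot, ∀ z ∈ ψ.isAutFlow.fixedSubgroup,
      u * z ∈ ψ.isAutFlow.contractedSubgroup atTop → u * z = 1 := fun u hu z hz huz =>
    ψ.eq_one_of_tendsto b hr hu hz huz
  have hball : {s : ι → ℝ | ‖s‖ ≤ 1} ∈ 𝓝 (0 : ι → ℝ) := by
    filter_upwards [Metric.closedBall_mem_nhds (0 : ι → ℝ) one_pos] with s hs
    simpa using hs
  refine
    { flow := φ.isAutFlow
      map_stable := fun t x hx => ψ.isAutFlow.map_mem_contractedSubgroup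
        (φ.isAutFlow.continuous_apply t) (φ.map_one t) (fun s x => hcomm s t x) hx
      map_central := fun t x hx => ψ.isAutFlow.map_mem_fixedSubgroup (fun s x => hcomm s t x) hx
      map_unstable := fun t x hx => ψ.isAutFlow.map_mem_contractedSubgroup
        (φ.isAutFlow.continuous_apply t) (φ.map_one t) (fun s x => hcomm s t x) hx
      conj_mem := fun z hz u hu => ψ.isAutFlow.map_mem_contractedSubgroup
        (f := fun u => z * u * z⁻¹) (by fun_prop) (by simp)
        (fun t x => by rw [ψ.map_mul', ψ.map_mul', ψ.map_inv, hz t]) hu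
      eq_one_of_mem_stable := hdisj
      eq_one_of_mem_central := fun u hu hu' => by
        rw [IsAutFlow.mem_contractedSubgroup] at hu
        simp only [hu' _] at hu
        exact tendsto_nhds_unique tendsto_const_nhds hu
      tendsto_stable := ?_
      local_product := ?_ }
  · intro g hg
    -- To see that `φ` contracts all of `S`, move `g` by `ψ_T` into the coordinate neighbourhood.
    -- Uniqueness removes the `U` and `Z` factors, `φ` contracts the remaining product, and
    -- `ψ_{-T}`, which commutes with `φ`, brings the limit back.
    have hU : curveProd γ (Lp ++ (Lz ++ Ln)) '' {s : ι → ℝ | ‖s‖ ≤ 1} ∈ 𝓝 (1 : G) :=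
      hnhds (image_mem_map hball)
    obtain ⟨T, s, hs, hT⟩ := ((ψ.isAutFlow.mem_contractedSubgroup.mp hg).eventually_mem hU).exists
    rw [curveProd_append, curveProd_append, ← mul_assoc] at hT
    have h1 := hdisj _ (hmemp s) _ (hmemz s) (by
      rw [eq_mul_inv_of_mul_eq hT]
      refine Subgroup.mul_mem _ ?_ (Subgroup.inv_mem _ (hmemn s))
      exact ψ.isAutFlow.map_mem_contractedSubgroup (ψ.isAutFlow.continuous_apply T)
        (ψ.map_one T) (fun t x => by rw [← ψ.map_add', ← ψ.map_add', add_comm]) hg)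
    rw [h1, one_mul] at hT
    have h2 : Tendsto (fun t => φ t (curveProd γ Ln s)) atTop (𝓝 1) := fun W hW =>
      (hunif W hW).mono fun t ht => ht s hs
    have h3 := ((ψ.isAutFlow.continuous_apply (-T)).tendsto 1).comp h2
    rw [ψ.map_one] at h3
    simpa only [Function.comp_def, hT, hcomm, ψ.isAutFlow.neg_apply_apply] using h3
  · intro V hV
    -- The bound on the parameters makes the contraction of `C` uniform.
    refine ⟨curveProd γ Ln '' {s : ι → ℝ | ‖s‖ ≤ 1 ∧ curveProd γ Ln s ∈ V}, ?_, ?_, ?_⟩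
    · rintro _ ⟨s, hs, rfl⟩
      exact ⟨hmemn s, hs.2⟩
    · intro W hW
      filter_upwards [hunif W hW] with t ht
      rintro _ ⟨s, hs, rfl⟩
      exact ht s hs.1
    · have hN : ∀ L, {s : ι → ℝ | curveProd γ L s ∈ V} ∈ 𝓝 (0 : ι → ℝ) := fun L =>
        (continuous_curveProd hγ L).continuousAt.preimage_mem_nhds
          (by rwa [curveProd_zero hγ])
      filter_upwards [hnhds (image_mem_map (inter_mem hball (inter_mem (hN Lz) (hN Ln))))]
      rintro _ ⟨s, ⟨hs, hsz, hsn⟩, rfl⟩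
      refine ⟨_, hmemp s, _, hmemz s, hsz, _, ⟨s, ⟨hs, hsn⟩, rfl⟩, ?_⟩
      rw [curveProd_append, curveProd_append, mul_assoc]

/-- Two flows of automorphisms of a connected group with the same differential agree. -/
theorem apply_eq_of_differential_eq [ConnectedSpace G] {φ ψ : AutFlow E G}
    {t : ℝ} (h : φ.differential t = ψ.differential t) (g : G) : φ t g = ψ t g := by
  have : IsTopologicalGroup G := topologicalGroup_of_lieGroup 𝓘(ℝ, E) ∞
  let b := Module.finBasis ℝ E
  choose γ hγ using fun i => exists_hasGenerator (G := G) (b i)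
  -- The set of agreement contains the one-parameter subgroups of a basis, hence a neighbourhood of
  -- `1`; an open subgroup of a connected group is everything.
  let H : Subgroup G :=
    { carrier := {g | φ t g = ψ t g}
      mul_mem' := fun {a b} ha hb => by
        simp only [mem_ofPred] at ha hb ⊢
        rw [φ.map_mul', ψ.map_mul', ha, hb]
      one_mem' := by simp only [mem_ofPred, φ.map_one, ψ.map_one]
      inv_mem' := fun {a} ha => by
        simp only [mem_ofPred] at ha ⊢
        rw [φ.map_inv, ψ.map_inv, ha] }
  have hmem : ∀ i s, γ i s ∈ H := fun i s => by
    have h' := (hγ i).comp_flow ψ t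
    rw [← h] at h'
    exact congrFun (((hγ i).comp_flow φ t).unique h') s
  have hn : (H : Set G) ∈ 𝓝 1 := by
    refine nhds_one_le_map_curveProd b hγ (Finset.nodup_toList Finset.univ)
      (fun i => by simp) ?_
    exact mem_map.mpr (univ_mem' fun s => curveProd_mem (fun i _ => hmem i) s)
  have hopen : IsOpen (H : Set G) := H.isOpen_of_mem_nhds hn
  have huniv := IsClopen.eq_univ ⟨H.isClosed_of_isOpen hopen, hopen⟩ ⟨1, H.one_mem⟩
  exact (huniv ▸ mem_univ g : g ∈ (H : Set G))

end AutFlow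

theorem IsHyperbolic.exists_eigenbasis {V : Type*} [AddCommGroup V] [Module ℝ V]
    [FiniteDimensional ℝ V] {D : Module.End ℝ V} (hD : IsHyperbolic D) :
    ∃ (n : ℕ) (b : Module.Basis (Fin n) ℝ V) (r : Fin n → ℝ), ∀ i, D (b i) = r i • b i := by
  have hspan : ⊤ ≤ Submodule.span ℝ {X : V | ∃ r : ℝ, D X = r • X} := by
    rw [← hD.iSup_eigenspace_eq_top]
    exact iSup_le fun r X hX => Submodule.subset_span ⟨r, Module.End.mem_eigenspace_iff.mp hX⟩
  let b := Module.Basis.ofSpan hspan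
  have : Fintype _ := FiniteDimensional.fintypeBasisIndex b
  have hb : ∀ i, ∃ r : ℝ, D (b i) = r • b i := fun i =>
    Module.Basis.ofSpan_subset hspan ⟨i, rfl⟩
  choose r hr using hb
  exact ⟨_, b.reindex (Fintype.equivFin _), fun i => r ((Fintype.equivFin _).symm i),
    fun i => by simpa using hr _⟩

/-- The splitting of a group into the single factor `⊤`. -/
theorem IsAutFlow.trivialSplitting {K : Type*} [Group K] [TopologicalSpace K] {φ : ℝ → K → K}
    (hφ : IsAutFlow φ) : HyperbolicSplitting φ ⊥ ⊤ ⊥ where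
  flow := hφ
  map_stable t x hx := by
    rw [Subgroup.mem_bot] at hx ⊢
    rw [hx, hφ.map_one]
  map_central _ _ _ := Subgroup.mem_top _
  map_unstable t x hx := by
    rw [Subgroup.mem_bot] at hx ⊢
    rw [hx, hφ.map_one]
  conj_mem z _ u hu := by
    rw [Subgroup.mem_bot] at hu ⊢
    simp [hu]
  eq_one_of_mem_stable _ _ _ _ h := Subgroup.mem_bot.mp h
  eq_one_of_mem_central u hu _ := Subgroup.mem_bot.mp hu
  tendsto_stable s hs := by
    rw [Subgroup.mem_bot.mp hs]
    simpa only [hφ.map_one] using tendsto_const_nhds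
  local_product V hV := by
    refine ⟨{1}, by simpa using mem_of_mem_nhds hV, ?_, ?_⟩
    · intro W hW
      exact Eventually.of_forall fun t => by simpa [hφ.map_one] using mem_of_mem_nhds hW
    · filter_upwards [hV] with x hx
      exact ⟨1, Subgroup.one_mem _, x, Subgroup.mem_top x, hx, 1, rfl, by simp⟩

/-! ### The splitting attached to a Jordan decomposition -/

namespace AutFlow

variable {E : Type*} [NormedAddCommGroup E] [NormedSpace ℝ E]
  {G : Type*} [TopologicalSpace G] [ChartedSpace E G] [Group G]

theorem derivation_eq (φ : AutFlow E G) :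
    (φ.derivation : E →ₗ[ℝ] E) = ((deriv φ.differential 0 : E →L[ℝ] E) : E →ₗ[ℝ] E) := rfl

theorem differential_comp₃ {φ ψ χ η : AutFlow E G} {t : ℝ}
    (h : ∀ x, φ t x = ψ t (χ t (η t x))) :
    φ.differential t = ψ.differential t * χ.differential t * η.differential t := by
  have h1 : HasMFDerivAt 𝓘(ℝ, E) 𝓘(ℝ, E) (ψ t) (χ t (η t (1 : G))) (ψ.differential t) := by
    rw [η.map_one, χ.map_one]
    exact ψ.hasMFDerivAt t
  have h2 : HasMFDerivAt 𝓘(ℝ, E) 𝓘(ℝ, E) (χ t) (η t (1 : G)) (χ.differential t) := by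
    rw [η.map_one]
    exact χ.hasMFDerivAt t
  have h3 := h1.comp (1 : G) (h2.comp (1 : G) (η.hasMFDerivAt t))
  rw [← (funext h : φ.toFun t = ψ.toFun t ∘ χ.toFun t ∘ η.toFun t)] at h3
  exact hasMFDerivAt_unique (φ.hasMFDerivAt t) h3

variable [FiniteDimensional ℝ E] [LieGroup 𝓘(ℝ, E) ∞ G] {φ φH φE φN : AutFlow E G}

theorem IsJordanDecomposition.differential_eigenvector (hJ : IsJordanDecomposition φ φH φE φN)
    {X : E} {r : ℝ} (hX : ((jordanParts φ.derivation).1 : E →ₗ[ℝ] E) X = r • X) (t : ℝ) :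
    φH.differential t X = Real.exp (r * t) • X := by
  rw [← hJ.derivation_H] at hX
  exact φH.isLinearFlow_differential.apply_eigenvector hX t

/-- On an eigenvector of `D_H`, `dφ_t X = e^{rt} dφ^E_t dφ^N_t X`. The condition `r t = -(a |t|)`
covers `r < 0` at `+∞` and `r > 0` at `-∞` together. -/
theorem IsJordanDecomposition.tendsto_differential (hJ : IsJordanDecomposition φ φH φE φN)
    {X : E} {r a : ℝ} (hX : ((jordanParts φ.derivation).1 : E →ₗ[ℝ] E) X = r • X) (ha : 0 < a)
    {l : Filter ℝ} (hl : Tendsto (fun t => |t|) l atTop) (hr : ∀ᶠ t in l, r * t = -(a * |t|)) :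
    Tendsto (fun t => φ.differential t X) l (𝓝 0) := by
  have hE : IsElliptic ((deriv φE.differential 0 : E →L[ℝ] E) : Module.End ℝ E) := by
    rw [← derivation_eq, hJ.derivation_E]
    exact (jordanParts_spec φ.derivation).elliptic
  have hN : IsNilpotent ((deriv φN.differential 0 : E →L[ℝ] E) : Module.End ℝ E) := by
    rw [← derivation_eq, hJ.derivation_N]
    exact (jordanParts_spec φ.derivation).nilpotent
  refine (φE.isLinearFlow_differential.tendsto_smul_of_isElliptic_of_isNilpotent hE
    φN.isLinearFlow_differential hN ha hl X).congr' ?_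
  filter_upwards [hr] with t ht
  have hcomp : φ.differential t = φE.differential t * φN.differential t * φH.differential t :=
    differential_comp₃ fun x => by rw [hJ.eq_comp, hJ.commute_HE, hJ.commute_HN]
  rw [hcomp, ← ht]
  simp only [mul_apply_eq_comp, hJ.differential_eigenvector hX, map_smul]

/-- The vectors contracted along `l` by the differential. -/
def contractedSubspace (ψ : AutFlow E G) (l : Filter ℝ) :
    Submodule ℝ (GroupLieAlgebra 𝓘(ℝ, E) G) where
  carrier := {X | Tendsto (fun t => ψ.differential t (X : E)) l (𝓝 (0 : E))}
  add_mem' {X Y} hX hY := by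
    have h : Tendsto (fun t => ψ.differential t (X : E) + ψ.differential t (Y : E)) l
        (𝓝 (0 + 0 : E)) := Tendsto.add hX hY
    rw [add_zero] at h
    exact h.congr fun t => ((ψ.differential t).map_add X Y).symm
  zero_mem' := tendsto_const_nhds.congr fun t => ((ψ.differential t).map_zero).symm
  smul_mem' c X hX := by
    have h : Tendsto (fun t => c • ψ.differential t (X : E)) l (𝓝 (c • (0 : E))) :=
      Tendsto.const_smul hX c
    rw [smul_zero] at h
    exact h.congr fun t => ((ψ.differential t).map_smul c X).symm

theorem IsJordanDecomposition.eigenspace_le (hJ : IsJordanDecomposition φ φH φE φN) {r : ℝ}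
    {l : Filter ℝ} (hl : Tendsto (fun t => r * t) l atBot) :
    Module.End.eigenspace (jordanParts φ.derivation).1 r ≤ φH.contractedSubspace l := by
  intro X hX
  have hX' := Module.End.mem_eigenspace_iff.mp hX
  have h : Tendsto (fun t => Real.exp (r * t) • (X : E)) l (𝓝 ((0 : ℝ) • (X : E))) :=
    (Real.tendsto_exp_atBot.comp hl).smul_const (X : E)
  rw [zero_smul] at h
  exact h.congr fun t => (hJ.differential_eigenvector hX' t).symm

variable [T2Space G]

/-- The generators `γ(1)` suffice: `ψ_t ∘ γ` is generated by `dψ_t X → 0`, so its value at `1` tends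
to the identity. This places `G^±` inside the contracted subgroups. -/
theorem connectedSubgroup_le_contractedSubgroup [IsTopologicalGroup G] (ψ : AutFlow E G)
    {l : Filter ℝ} (h : Submodule ℝ (GroupLieAlgebra 𝓘(ℝ, E) G))
    (hX : ∀ X ∈ h, Tendsto (fun t => ψ.differential t (X : E)) l (𝓝 0)) :
    connectedSubgroup (E := E) h ≤ ψ.isAutFlow.contractedSubgroup l := by
  refine (Subgroup.closure_le _).mpr ?_
  rintro _ ⟨X, hXh, γ, hγ, rfl⟩
  rw [SetLike.mem_coe, IsAutFlow.mem_contractedSubgroup]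
  intro V hV
  obtain ⟨δ, hδ, hb⟩ := exists_generator_bound (E := E) hV
  refine mem_map.mpr ?_
  filter_upwards [(hX X hXh).norm.eventually_lt_const (by simpa using hδ)] with t ht
  exact hb _ _ (hγ.hasGenerator.comp_flow ψ t) ht 1 (by simp)

/-- Hyperbolic parts of two decompositions have the same derivation, hence the same differential on
an eigenbasis, hence agree on the connected group; testing one decomposition is enough. -/
theorem IsJordanDecomposition.centralSubgroup_eq [ConnectedSpace G]
    (hJ : IsJordanDecomposition φ φH φE φN) :
    φ.centralSubgroup = φH.isAutFlow.fixedSubgroup := by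
  obtain ⟨n, b, r, hr⟩ := (jordanParts_spec φ.derivation).hyperbolic.exists_eigenbasis
  refine le_antisymm (fun g hg => hg φH φE φN hJ) fun g hg φH' φE' φN' hJ' t => ?_
  have hd : φH'.differential t = φH.differential t := by
    refine ContinuousLinearMap.coe_injective (b.ext fun i => ?_)
    exact (hJ'.differential_eigenvector (hr i) t).trans (hJ.differential_eigenvector (hr i) t).symm
  rw [apply_eq_of_differential_eq hd]
  exact hg t

theorem IsJordanDecomposition.stableSubgroup_le [IsTopologicalGroup G]
    (hJ : IsJordanDecomposition φ φH φE φN) :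
    φ.stableSubgroup ≤ φH.isAutFlow.contractedSubgroup atTop :=
  φH.connectedSubgroup_le_contractedSubgroup _ fun _ hX =>
    (iSup₂_le fun _ hr => hJ.eigenspace_le (tendsto_id.const_mul_atTop_of_neg hr) :
      stableSubspace φ.derivation ≤ φH.contractedSubspace atTop) hX

theorem IsJordanDecomposition.unstableSubgroup_le [IsTopologicalGroup G]
    (hJ : IsJordanDecomposition φ φH φE φN) :
    φ.unstableSubgroup ≤ φH.isAutFlow.contractedSubgroup atBot :=
  φH.connectedSubgroup_le_contractedSubgroup _ fun _ hX =>
    (iSup₂_le fun _ hr => hJ.eigenspace_le (tendsto_id.const_mul_atBot hr) :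
      unstableSubspace φ.derivation ≤ φH.contractedSubspace atBot) hX

theorem IsJordanDecomposition.hyperbolicSplitting [IsTopologicalGroup G]
    (hJ : IsJordanDecomposition φ φH φE φN) :
    HyperbolicSplitting φ.toFun (φH.isAutFlow.contractedSubgroup atTop)
        φH.isAutFlow.fixedSubgroup (φH.isAutFlow.contractedSubgroup atBot) ∧
      HyperbolicSplitting (fun t => φ (-t)) (φH.isAutFlow.contractedSubgroup atBot)
        φH.isAutFlow.fixedSubgroup (φH.isAutFlow.contractedSubgroup atTop) := by
  obtain ⟨n, b, r, hr⟩ : ∃ (n : ℕ) (b : Module.Basis (Fin n) ℝ E) (r : Fin n → ℝ),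
      ∀ i, ((jordanParts φ.derivation).1 : E →ₗ[ℝ] E) (b i) = r i • b i :=
    (jordanParts_spec φ.derivation).hyperbolic.exists_eigenbasis
  have hcomm : ∀ s t x, φH s (φ t x) = φ t (φH s x) := fun s t x => by
    rw [hJ.eq_comp, hJ.eq_comp, ← hJ.commute_HN, ← hJ.commute_HE, ← φH.map_add',
      ← φH.map_add', add_comm]
  have heig : ∀ i t, φH.differential t (b i) = Real.exp (r i * t) • b i := fun i =>
    hJ.differential_eigenvector (hr i)
  constructor
  · refine AutFlow.hyperbolicSplitting φ φH hcomm b heig fun i hi => ?_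
    refine hJ.tendsto_differential (hr i) (neg_pos.mpr hi) tendsto_abs_atTop_atTop ?_
    filter_upwards [eventually_ge_atTop 0] with t ht
    rw [abs_of_nonneg ht, neg_mul, neg_neg]
  -- Time reversal negates the exponents, so the directions to be contracted are those with `r i >
  -- 0`, as `t → -∞`.
  · have h := AutFlow.hyperbolicSplitting φ.reverse φH.reverse (fun s t x => hcomm (-s) (-t) x) b
      (r := fun i => -r i) (fun i t => by
        rw [reverse_differential, heig, neg_mul, mul_neg]) fun i hi => by
        have h1 := hJ.tendsto_differential (l := atBot) (hr i) (neg_neg_iff_pos.mp hi)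
          tendsto_abs_atBot_atTop (by
            filter_upwards [eventually_le_atBot 0] with t ht
            rw [abs_of_nonpos ht, mul_neg, neg_neg])
        exact h1.comp tendsto_neg_atTop_atBot
    have e1 := φH.isAutFlow.contractedSubgroup_reverse_atTop
    have e2 := φH.isAutFlow.contractedSubgroup_reverse_atBot
    have e3 := φH.isAutFlow.fixedSubgroup_reverse
    rw [← e1, ← e2, ← e3]
    exact h

end AutFlow

end ChainRec

end

theorem theorem3p5 {E : Type*} [NormedAddCommGroup E] [NormedSpace ℝ E] [FiniteDimensional ℝ E]
    {G : Type*} [TopologicalSpace G] [ChartedSpace E G] [Group G]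
    [LieGroup 𝓘(ℝ, E) ∞ G] [T2Space G] [ConnectedSpace G] (φ : ChainRec.AutFlow E G) :
    ChainRec.chainRecurrentSet φ ∩
        (((φ.unstableSubgroup : Set G) * (φ.centralSubgroup : Set G)) * (φ.stableSubgroup : Set G)) =
      (Subtype.val '' ChainRec.chainRecurrentSet φ.restrictCentral : Set G) := by
  have : IsTopologicalGroup G := topologicalGroup_of_lieGroup 𝓘(ℝ, E) ∞
  have hψ : ∀ t (z : φ.centralSubgroup), (φ.restrictCentral t z : G) = φ t z := fun _ _ => rfl
  ext x
  constructor
  · rintro ⟨hx, hx'⟩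
    by_cases hJ : ∃ φH φE φN, ChainRec.AutFlow.IsJordanDecomposition φ φH φE φN
    · obtain ⟨φH, φE, φN, hJ⟩ := hJ
      have hS := hJ.hyperbolicSplitting
      rw [← hJ.centralSubgroup_eq] at hS
      -- Only `G^± ⊆` contracted subgroups is needed, since the equality holds for the larger
      -- product `U Z S`.
      rw [← hS.1.chainRecurrentSet_inter hS.2 φ.restrictCentral hψ]
      exact ⟨hx, Set.mul_subset_mul (Set.mul_subset_mul_right hJ.unstableSubgroup_le)
        hJ.stableSubgroup_le hx'⟩
    -- Without a decomposition to test against, the central subgroup is the whole group.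
    · have hS := φ.isAutFlow.trivialSplitting
      have htop : φ.centralSubgroup = ⊤ := top_le_iff.mp fun g _ φH φE φN h =>
        absurd ⟨φH, φE, φN, h⟩ hJ
      rw [← htop] at hS
      exact ⟨⟨x, htop ▸ Subgroup.mem_top x⟩,
        hS.mem_chainRecurrentSet_restrict ⟨x, _⟩ hx φ.restrictCentral hψ, rfl⟩
  · rintro ⟨z, hz, rfl⟩
    exact ⟨ChainRec.mem_chainRecurrentSet_of_restrict hψ hz, z,
      ⟨1, Subgroup.one_mem _, z, z.2, one_mul _⟩, 1, Subgroup.one_mem _, mul_one _⟩
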